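/- **Setup.** For real $N>0$ let $X=(X_t)_{t\ge 0}$ be the continuous-time simple random walk on $\mathbb Z^2\cup\{\Delta\}$ that jumps from $x\in\mathbb Z^2$ to each of its four neighbours at rate $\tfrac14$ and to the absorbing cemetery $\Delta$ at rate $N^{-2}$; $P_x$ is its law when $X_0=x$. For finite $K\subset\mathbb Z^2$ let $$\mathrm{cap}_N(K)=\sum_{x\in K}(1+N^{-2})\,P_x(\widetilde H_K=\infty),\qquad \widetilde H_K=\inf\{t>0: X_t\in K \text{ and } X_s\ne X_0\text{ for some }s\in(0,t)\}.$$ For Borel $F\subset\mathbb R^2$ let $\mathrm{cap}^{\tau}_{\mathbb R^2}(F)$ be the capacity of $F$ for planar Brownian motion with variance $\tfrac12$ (per coordinate) at time $1$, killed at an independent exponential time $\tau$ of mean one, that is, $$\big(\mathrm{cap}^{\tau}_{\mathbb R^2}(F)\big)^{-1}=\inf_{\mu}\iint \frac2\pi K_0(2|x-y|)\,d\mu(x)\,d\mu(y),\qquad K_0(s)=\int_0^\infty\frac1{2t}\,e^{-s^2/(4t)-t}\,dt,$$ where $\mu$ ranges over the probability measures on $F$. Identify $[0,1]$ with $[0,1]\times\{0\}\subset\mathbb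 R^2$. Write $|\cdot|$ for the Euclidean norm, $B_r=\{z\in\mathbb Z^2:|z|\le r\}$ and $d(S,S')=\inf\{|x-y|:x\in S,\,y\in S'\}$. **Proposition.** For all $\varepsilon,\delta\in(0,1)$ there exist $c_1\in(0,1)$, $c_2>0$ and $C<\infty$, all depending only on $\varepsilon$ and $\delta$, such that for all real $N\ge C$, all integers $P\in[C,N]$, all $A\subset\{1,\dots,P\}$ with $c_1P\le|A|\le P$, and all families $(S_i)_{i\in A}$ of subsets of $B_{2N}$, the following hold. (i) If $d(S_i,S_j)\ge(|i-j|-\delta)\,N/P$ for all $i\ne j$ in $A$, and if $\kappa>0$ is such that $\mathrm{cap}_N(S_i)\ge\kappa$ for all $i\in A$, then $$\mathrm{cap}_N\Big(\bigcup_{i\in A}S_i\Big)\ \ge\ \Big[(c_2\kappa P)^{-1}+(1+\varepsilon)\big(\mathrm{cap}^{\tau}_{\mathbb R^2}([0,1])\big)^{-1}\Big]^{-1}.$$ (ii) If $|x_1-x_2|\le(|i-j|+1/\delta)\,N/P$ for all $i,j\in A$, $x_1\in S_i$ and $x_2\in S_j$, then $$\mathrm{cap}_N\Big(\bigcup_{i\in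 A}S_i\Big)\ \le\ (1+\varepsilon)\,\mathrm{cap}^{\tau}_{\mathbb R^2}([0,1]).$$ -/

import Mathlib

open MeasureTheory ProbabilityTheory Set
open scoped ENNReal

namespace PorousTube

noncomputable section

/-! ### Euclidean geometry of the lattice -/

/-- The plane `ℝ²` with its Euclidean distance. -/
abbrev Plane : Type := EuclideanSpace ℝ (Fin 2)

/-- The inclusion `ℤ² ⊂ ℝ²`. -/
def toPlane (z : ℤ × ℤ) : Plane := !₂[(z.1 : ℝ), (z.2 : ℝ)]

/-- The Euclidean distance `|x - y|` of two lattice points. -/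
def eucl (x y : ℤ × ℤ) : ℝ := dist (toPlane x) (toPlane y)

/-- The closed Euclidean ball `B_r = {z ∈ ℤ² : |z| ≤ r}`. -/
def latticeBall (r : ℝ) : Set (ℤ × ℤ) := {z | eucl z 0 ≤ r}

/-- `d(A, B) = inf {|a - b| : a ∈ A, b ∈ B}`, with `inf ∅ = ∞`. -/
def setDist (A B : Set (ℤ × ℤ)) : ℝ≥0∞ :=
  ⨅ (a ∈ A) (b ∈ B), ENNReal.ofReal (eucl a b)

/-! ### The walk on `ℤ² ∪ {Δ}` with unit jump rate and killing rate `N⁻²`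

The cemetery `Δ` is `none`. The generator is
`L f(x) = ∑_{y ∼ x} (f(y) - f(x)) / 4 - N⁻² f(x)`. The total rate out of any `x ∈ ℤ²` is
`1 + N⁻²`, so the chain is built from independent exponential clocks of that rate and from
independent jumps: to each neighbour with probability `(1/4) / (1 + N⁻²)` and to `Δ` with
probability `N⁻² / (1 + N⁻²)`. -/

/-- The total rate `λ_x = 1 + N⁻²`. -/
def totalRate (N : ℝ) : ℝ := 1 + (N ^ 2)⁻¹

lemma totalRate_pos (N : ℝ) : 0 < totalRate N := by
  unfold totalRate
  positivity

/-- The four unit vectors. -/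
def unitSteps : Finset (ℤ × ℤ) := {(1, 0), (-1, 0), (0, 1), (0, -1)}

instance : MeasurableSpace (Option (ℤ × ℤ)) := ⊤

/-- The law of one jump: `some e` is a jump by the unit vector `e`, `none` a jump to `Δ`. -/
def stepLaw (N : ℝ) : Measure (Option (ℤ × ℤ)) :=
  ENNReal.ofReal ((N ^ 2)⁻¹ / totalRate N) • Measure.dirac none +
    ∑ e ∈ unitSteps, ENNReal.ofReal ((1 / 4) / totalRate N) • Measure.dirac (some e)

instance (N : ℝ) : IsProbabilityMeasure (stepLaw N) := by
  constructor
  have h := totalRate_pos N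
  have hc : unitSteps.card = 4 := rfl
  simp only [stepLaw, Measure.coe_add, Measure.coe_smul, Measure.coe_finsetSum, Pi.add_apply,
    Pi.smul_apply, Finset.sum_apply, measure_univ, smul_eq_mul, mul_one, Finset.sum_const, hc]
  rw [← ENNReal.ofReal_nsmul, ← ENNReal.ofReal_add (by positivity) (by positivity),
    ← ENNReal.ofReal_one]
  congr 1
  rw [nsmul_eq_mul]
  field_simp
  unfold totalRate
  push_cast
  ring

/-- The law of one holding time: exponential of rate `1 + N⁻²`. -/
def clockLaw (N : ℝ) : Measure ℝ := expMeasure (totalRate N)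

instance (N : ℝ) : IsProbabilityMeasure (clockLaw N) :=
  isProbabilityMeasure_expMeasure (totalRate_pos N)

/-- The sample space: a sequence of jumps and a sequence of holding times. -/
abbrev Sample : Type := (ℕ → Option (ℤ × ℤ)) × (ℕ → ℝ)

/-- The probability on the sample space: all jumps and all holding times are independent. -/
def walkLaw (N : ℝ) : Measure Sample :=
  (Measure.infinitePi fun _ : ℕ => stepLaw N).prod (Measure.infinitePi fun _ : ℕ => clockLaw N)

/-- The successive states visited by the walk started at `x`; `Δ` is absorbing. -/
def jumpChain (x : ℤ × ℤ) (ξ : ℕ → Option (ℤ × ℤ)) : ℕ → Option (ℤ × ℤ)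
  | 0 => some x
  | n + 1 =>
    match jumpChain x ξ n, ξ n with
    | some z, some e => some (z + e)
    | _, _ => none

/-- The time of the `n`-th jump. -/
def jumpTime (σ : ℕ → ℝ) (n : ℕ) : ℝ := ∑ k ∈ Finset.range n, σ k

open Classical in
/-- The walk `X_t` started at `x`: it sits at the `n`-th visited state during the interval
from the `n`-th to the `(n+1)`-st jump time. -/
def walk (x : ℤ × ℤ) (ω : Sample) (t : ℝ) : Option (ℤ × ℤ) :=
  if h : ∃ n, t < jumpTime ω.2 (n + 1) then jumpChain x ω.1 (Nat.find h) else none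

/-- The hitting time
`H̃_K = inf {t > 0 : X_t ∈ K and X_s ≠ X_0 for some s ∈ (0, t)}`, with `inf ∅ = ∞`. -/
def returnTime (K : Set (ℤ × ℤ)) (x : ℤ × ℤ) (ω : Sample) : EReal :=
  sInf ((fun t : ℝ => (t : EReal)) ''
    {t : ℝ | 0 < t ∧ walk x ω t ∈ some '' K ∧ ∃ s ∈ Ioo 0 t, walk x ω s ≠ walk x ω 0})

/-- The equilibrium measure `e_{K,N}(x) = λ_x P_x(H̃_K = ∞)`, for `x ∈ K`. -/
def equilibrium (N : ℝ) (K : Set (ℤ × ℤ)) (x : ℤ × ℤ) : ℝ≥0∞ :=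
  ENNReal.ofReal (totalRate N) * walkLaw N {ω | returnTime K x ω = ⊤}

/-- The capacity `cap_N(K)`, the total mass of the equilibrium measure of `K`. -/
def capN (N : ℝ) (K : Set (ℤ × ℤ)) : ℝ≥0∞ := ∑' x : K, equilibrium N K x

/-! ### The capacity of killed Brownian motion in the plane -/

/-- The modified Bessel function
`K_0(s) = ∫_0^∞ (2t)⁻¹ exp(-s² / (4t) - t) dt`; in particular `K_0(0) = ∞`. -/
def besselK0 (s : ℝ) : ℝ≥0∞ :=
  ∫⁻ t in Ioi (0 : ℝ), ENNReal.ofReal (1 / (2 * t) * Real.exp (-s ^ 2 / (4 * t) - t))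

/-- The energy `∫∫ (2/π) K_0(2 |x - y|) dμ(x) dμ(y)`. -/
def energy (μ : Measure Plane) : ℝ≥0∞ :=
  ∫⁻ x, ∫⁻ y, ENNReal.ofReal (2 / Real.pi) * besselK0 (2 * dist x y) ∂μ ∂μ

/-- The capacity of `A ⊂ ℝ²` for Brownian motion of variance `1/2` killed at an independent
exponential time of mean one: the inverse of the least energy of a probability measure on `A`. -/
def capBrownian (A : Set Plane) : ℝ≥0∞ :=
  (⨅ (μ : Measure Plane) (_ : IsProbabilityMeasure μ) (_ : μ Aᶜ = 0), energy μ)⁻¹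

/-- The segment `[0,1]`, viewed as `[0,1] × {0} ⊂ ℝ²`. -/
def unitSegment : Set Plane := {z | z 0 ∈ Icc (0 : ℝ) 1 ∧ z 1 = 0}

end

end PorousTube

/-!
The equilibrium measure of a finite set has potential one on the set, for the Green function `g` of
the killed walk, and `g` is positive semidefinite. By the Cauchy-Schwarz inequality every mass
distribution `ν` on `K` therefore satisfies `ν(K)² ≤ ⟨ν, g ν⟩ cap(K)`. The local central limit
theorem shows that `g(x)` is close to the Green function of killed Brownian motion at distance
`|x| / N`, with a relative error that is uniform over the scales of the problem.

For the lower bound, `ν` is a mixture of the normalized equilibrium measures of the `S_i`, whose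
weights come from a nearly optimal probability measure of bounded density on the segment. The
diagonal terms of its energy are at most of order `1 / (κ P)`, and the others are compared with the
Brownian energy of that measure, because the `S_i` are as far apart as the points `i / P`.

For the upper bound, the equilibrium mass of the union carried by `S_i` is spread over the `i`-th
interval of length `1 / P`. This yields a measure on the segment whose Brownian energy is at most
`1 + ε` times the capacity of the union, because the potential of the equilibrium measure is one
and the `S_i` are not much farther apart than those intervals.
-/

open scoped Topology

namespace PorousTube

noncomputable section

/-! ### The embedded jump chain -/

/-- The sequence with first term `a` followed by the terms of `ξ`. -/
def consSeq {α : Type*} (a : α) (ξ : ℕ → α) : ℕ → α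
  | 0 => a
  | n + 1 => ξ n

lemma measurable_consSeq {α : Type*} [MeasurableSpace α] :
    Measurable fun p : α × (ℕ → α) => consSeq p.1 p.2 := by
  refine measurable_pi_lambda _ fun n => ?_
  cases n with
  | zero => exact measurable_fst
  | succ n => exact (measurable_pi_apply n).comp measurable_snd

lemma map_consSeq_prod_infinitePi {α : Type*} [MeasurableSpace α] (μ : Measure α)
    [IsProbabilityMeasure μ] :
    (μ.prod (Measure.infinitePi fun _ : ℕ => μ)).map (fun p => consSeq p.1 p.2) =
      Measure.infinitePi fun _ : ℕ => μ := by
  classical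
  refine Measure.eq_infinitePi _ fun s t ht => ?_
  rw [Measure.map_apply measurable_consSeq (.pi s.countable_toSet fun i _ => ht i)]
  let T : ℕ → Set α := fun i => if i ∈ s then t i else univ
  have hT : ∀ i, MeasurableSet (T i) := fun i => by
    simp only [T]
    split_ifs
    exacts [ht i, .univ]
  obtain ⟨n, hn⟩ : ∃ n, s ⊆ Finset.range (n + 1) :=
    ⟨s.sup id, fun i hi => Finset.mem_range_succ_iff.2 (Finset.le_sup (f := id) hi)⟩
  have hst : (s : Set ℕ).pi t = (Finset.range (n + 1) : Set ℕ).pi T := by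
    ext ξ
    simp only [Set.mem_pi, Finset.mem_coe, T]
    refine ⟨fun h i _ => ?_, fun h i hi => by simpa only [if_pos hi] using h i (hn hi)⟩
    split_ifs with hi
    exacts [h i hi, mem_univ _]
  have hpre : (fun p : α × (ℕ → α) => consSeq p.1 p.2) ⁻¹' (Finset.range (n + 1) : Set ℕ).pi T =
      T 0 ×ˢ (Finset.range n : Set ℕ).pi fun i => T (i + 1) := by
    ext ⟨a, ξ⟩
    simp only [mem_preimage, Set.mem_pi, mem_prod, Finset.mem_coe, Finset.mem_range,
      Nat.forall_lt_succ_left]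
    rfl
  rw [hst, hpre, Measure.prod_prod, Measure.infinitePi_pi _ fun i _ => hT (i + 1), mul_comm,
    ← Finset.prod_range_succ' (fun i => μ (T i)), ← Finset.prod_subset hn]
  · exact Finset.prod_congr rfl fun i hi => by simp only [T, if_pos hi]
  · intro i _ hi
    simp only [T, if_neg hi, measure_univ]

/-- The law of the sequence of jumps, i.e. of the first coordinate under `walkLaw`. -/
def jumpLaw (N : ℝ) : Measure (ℕ → Option (ℤ × ℤ)) := Measure.infinitePi fun _ : ℕ => stepLaw N

instance (N : ℝ) : IsProbabilityMeasure (jumpLaw N) := by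
  unfold jumpLaw; infer_instance

lemma jumpChain_consSeq_none (x : ℤ × ℤ) (ξ : ℕ → Option (ℤ × ℤ)) (n : ℕ) :
    jumpChain x (consSeq none ξ) (n + 1) = none := by
  induction n with
  | zero => rfl
  | succ n ih => rw [jumpChain, ih]

lemma jumpChain_consSeq_some (x e : ℤ × ℤ) (ξ : ℕ → Option (ℤ × ℤ)) (n : ℕ) :
    jumpChain x (consSeq (some e) ξ) (n + 1) = jumpChain (x + e) ξ n := by
  induction n with
  | zero => rfl
  | succ n ih => rw [jumpChain, ih]; rfl

lemma measurable_jumpChain (x : ℤ × ℤ) (n : ℕ) : Measurable fun ξ => jumpChain x ξ n := by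
  induction n with
  | zero => exact measurable_const
  | succ n ih =>
    let next : Option (ℤ × ℤ) × Option (ℤ × ℤ) → Option (ℤ × ℤ) := fun p =>
      match p.1, p.2 with
      | some z, some e => some (z + e)
      | _, _ => none
    exact (measurable_of_countable next).comp (ih.prodMk (measurable_pi_apply n))

/-- The event that the jump chain started at `x` visits `K` at some time `n ≥ 0`. -/
def hitSet (K : Set (ℤ × ℤ)) (x : ℤ × ℤ) : Set (ℕ → Option (ℤ × ℤ)) :=
  {ξ | ∃ n, jumpChain x ξ n ∈ some '' K}

/-- The event that the jump chain started at `x` visits `K` at some time `n ≥ 1`. -/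
def returnSet (K : Set (ℤ × ℤ)) (x : ℤ × ℤ) : Set (ℕ → Option (ℤ × ℤ)) :=
  {ξ | ∃ n, jumpChain x ξ (n + 1) ∈ some '' K}

section HittingEvents

variable {K : Set (ℤ × ℤ)} {x : ℤ × ℤ}

lemma measurableSet_returnSet : MeasurableSet (returnSet K x) := by
  simp only [returnSet, ofPred_exists]
  exact .iUnion fun n => measurable_jumpChain x (n + 1) trivial

lemma hitSet_of_mem (hx : x ∈ K) : hitSet K x = univ :=
  eq_univ_of_forall fun _ => ⟨0, x, hx, rfl⟩

lemma hitSet_of_notMem (hx : x ∉ K) : hitSet K x = returnSet K x := by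
  have hstart : ∀ ξ, jumpChain x ξ 0 ∉ some '' K := fun ξ => by simpa [jumpChain] using hx
  ext ξ
  refine ⟨fun ⟨n, hn⟩ => ?_, fun ⟨n, hn⟩ => ⟨n + 1, hn⟩⟩
  cases n with
  | zero => exact absurd hn (hstart ξ)
  | succ n => exact ⟨n, hn⟩

end HittingEvents

lemma lintegral_stepLaw (N : ℝ) (f : Option (ℤ × ℤ) → ℝ≥0∞) :
    ∫⁻ a, f a ∂stepLaw N = ENNReal.ofReal ((N ^ 2)⁻¹ / totalRate N) * f none +
      ∑ e ∈ unitSteps, ENNReal.ofReal ((1 / 4) / totalRate N) * f (some e) := by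
  simp only [stepLaw, lintegral_add_measure, lintegral_smul_measure, lintegral_finsetSum_measure,
    lintegral_dirac, smul_eq_mul]

lemma jumpLaw_returnSet (N : ℝ) (K : Set (ℤ × ℤ)) (x : ℤ × ℤ) :
    jumpLaw N (returnSet K x) =
      ∑ e ∈ unitSteps, ENNReal.ofReal ((1 / 4) / totalRate N) * jumpLaw N (hitSet K (x + e)) := by
  have hmeas := measurable_consSeq (measurableSet_returnSet (K := K) (x := x))
  rw [jumpLaw, ← map_consSeq_prod_infinitePi, Measure.map_apply measurable_consSeq
    measurableSet_returnSet, Measure.prod_apply hmeas, lintegral_stepLaw]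
  simp [returnSet, hitSet, jumpChain_consSeq_none, jumpChain_consSeq_some,
    map_consSeq_prod_infinitePi]

/-! ### From the return time to the jump chain -/

lemma strictMono_jumpTime {σ : ℕ → ℝ} (hσ : ∀ n, 0 < σ n) : StrictMono (jumpTime σ) :=
  strictMono_nat_of_lt_succ fun n => by
    rw [jumpTime, jumpTime, Finset.sum_range_succ]
    exact lt_add_of_pos_right _ (hσ n)

section Paths

variable {x : ℤ × ℤ} {ω : Sample}

lemma walk_eq_jumpChain (hσ : ∀ n, 0 < ω.2 n) {n : ℕ} {t : ℝ}
    (ht : t ∈ Ico (jumpTime ω.2 n) (jumpTime ω.2 (n + 1))) : walk x ω t = jumpChain x ω.1 n := by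
  classical
  have h : ∃ n, t < jumpTime ω.2 (n + 1) := ⟨n, ht.2⟩
  have hfind : Nat.find h = n := (Nat.find_eq_iff h).2
    ⟨ht.2, fun m hm => not_lt.2 (((strictMono_jumpTime hσ).monotone hm).trans ht.1)⟩
  rw [walk, dif_pos h]
  congr 1

lemma walk_of_lt_jumpTime_one (hσ : ∀ n, 0 < ω.2 n) {t : ℝ} (ht₀ : 0 ≤ t)
    (ht : t < jumpTime ω.2 1) : walk x ω t = some x :=
  walk_eq_jumpChain hσ ⟨ht₀, ht⟩

lemma exists_walk_ne_iff (hσ : ∀ n, 0 < ω.2 n) (hξ : ω.1 0 ≠ some 0) {t : ℝ} :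
    (∃ s ∈ Ioo 0 t, walk x ω s ≠ walk x ω 0) ↔ jumpTime ω.2 1 < t := by
  have hmono := strictMono_jumpTime hσ
  have hpos : 0 < jumpTime ω.2 1 := hmono zero_lt_one
  rw [walk_of_lt_jumpTime_one hσ le_rfl hpos]
  constructor
  · rintro ⟨s, ⟨hs₀, hst⟩, hne⟩
    by_contra! ht
    exact hne (walk_of_lt_jumpTime_one hσ hs₀.le (hst.trans_le ht))
  · refine fun ht => ⟨jumpTime ω.2 1, ⟨hpos, ht⟩, ?_⟩
    rw [walk_eq_jumpChain hσ ⟨le_rfl, hmono (Nat.lt_succ_self 1)⟩]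
    simp only [jumpChain]
    cases hstep : ω.1 0 with
    | none => simp
    | some e => simpa [hstep] using hξ

lemma exists_walk_mem_iff (hσ : ∀ n, 0 < ω.2 n) (K : Set (ℤ × ℤ)) :
    (∃ t, jumpTime ω.2 1 < t ∧ walk x ω t ∈ some '' K) ↔ ω.1 ∈ returnSet K x := by
  have hmono := strictMono_jumpTime hσ
  constructor
  · rintro ⟨t, ht, hK⟩
    by_cases hex : ∃ n, t < jumpTime ω.2 (n + 1)
    · rw [walk, dif_pos hex] at hK
      obtain ⟨m, hm⟩ : ∃ m, Nat.find hex = m + 1 :=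
        Nat.exists_eq_succ_of_ne_zero fun h => ht.not_gt (by simpa [h] using Nat.find_spec hex)
      exact ⟨m, hm ▸ hK⟩
    · simp [walk, dif_neg hex] at hK
  · rintro ⟨n, hn⟩
    obtain ⟨t, ht⟩ := exists_between (hmono (Nat.lt_succ_self (n + 1)))
    refine ⟨t, (hmono.monotone (Nat.le_add_left 1 n)).trans_lt ht.1, ?_⟩
    rwa [walk_eq_jumpChain hσ ⟨ht.1.le, ht.2⟩]

lemma returnTime_eq_top_iff (hσ : ∀ n, 0 < ω.2 n) (hξ : ω.1 0 ≠ some 0) (K : Set (ℤ × ℤ)) :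
    returnTime K x ω = ⊤ ↔ ω.1 ∉ returnSet K x := by
  have hpos : 0 < jumpTime ω.2 1 := strictMono_jumpTime hσ zero_lt_one
  rw [returnTime, sInf_eq_top, ← exists_walk_mem_iff hσ]
  simp only [exists_walk_ne_iff hσ hξ, forall_mem_image, EReal.coe_ne_top, imp_false]
  exact ⟨fun h ⟨t, ht, hK⟩ => h ⟨hpos.trans ht, hK, ht⟩, fun h t ⟨_, hK, ht⟩ => h ⟨t, ht, hK⟩⟩

end Paths

lemma ae_stepLaw_ne_zero (N : ℝ) : ∀ᵐ a ∂stepLaw N, a ≠ some 0 := by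
  rw [ae_iff]
  simp only [ne_eq, not_not, ofPred_eq_eq_singleton, stepLaw, Measure.coe_add, Measure.coe_smul,
    Measure.coe_finsetSum, Pi.add_apply, Pi.smul_apply, Finset.sum_apply]
  simp [unitSteps]

lemma ae_expMeasure_pos {r : ℝ} (hr : 0 < r) : ∀ᵐ s ∂expMeasure r, 0 < s := by
  have := isProbabilityMeasure_expMeasure hr
  have hcdf := cdf_expMeasure_eq hr 0
  rw [cdf_eq_real, if_pos le_rfl, mul_zero, neg_zero, Real.exp_zero, sub_self] at hcdf
  simpa only [ae_iff, not_lt] using! (measureReal_eq_zero_iff).1 hcdf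

lemma walkLaw_returnTime (N : ℝ) (K : Set (ℤ × ℤ)) (x : ℤ × ℤ) :
    walkLaw N {ω | returnTime K x ω = ⊤} = jumpLaw N (returnSet K x)ᶜ := by
  have hclock : ∀ᵐ σ ∂(Measure.infinitePi fun _ : ℕ => clockLaw N), ∀ n, 0 < σ n :=
    ae_all_iff.2 fun n => (measurePreserving_eval_infinitePi (fun _ : ℕ => clockLaw N)
      n).quasiMeasurePreserving.ae (ae_expMeasure_pos (totalRate_pos N))
  have hstep : ∀ᵐ ξ ∂jumpLaw N, ξ 0 ≠ some 0 :=
    (measurePreserving_eval_infinitePi (fun _ : ℕ => stepLaw N) 0).quasiMeasurePreserving.ae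
      (ae_stepLaw_ne_zero N)
  have hevent : {ω | returnTime K x ω = ⊤} =ᵐ[walkLaw N]
      (returnSet K x)ᶜ ×ˢ (univ : Set (ℕ → ℝ)) := by
    rw [Filter.eventuallyEq_set]
    filter_upwards [Measure.quasiMeasurePreserving_snd.ae hclock,
      Measure.quasiMeasurePreserving_fst.ae hstep] with ω hσ hξ
    simpa [mem_prod] using returnTime_eq_top_iff hσ hξ K
  rw [measure_congr hevent, walkLaw, Measure.prod_prod, measure_univ, mul_one]
  rfl

/-! ### Hitting probabilities and the equilibrium measure -/

/-- The probability that the walk started at `x` visits `K`. -/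
def hitProb (N : ℝ) (K : Set (ℤ × ℤ)) (x : ℤ × ℤ) : ℝ := (jumpLaw N).real (hitSet K x)

open Classical in
/-- The equilibrium measure `equilibrium N K` as a real function on `ℤ²`, extended by zero
outside `K`. -/
def equil (N : ℝ) (K : Set (ℤ × ℤ)) (x : ℤ × ℤ) : ℝ :=
  if x ∈ K then totalRate N * (1 - (jumpLaw N).real (returnSet K x)) else 0

section Equilibrium

variable (N : ℝ) {K : Set (ℤ × ℤ)} {x : ℤ × ℤ}

lemma equil_of_notMem (hx : x ∉ K) : equil N K x = 0 := if_neg hx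

variable (K x)

lemma equil_nonneg : 0 ≤ equil N K x := by
  unfold equil
  split_ifs
  · exact mul_nonneg (totalRate_pos N).le (sub_nonneg.2 measureReal_le_one)
  · exact le_rfl

lemma hitProb_mem_Icc : hitProb N K x ∈ Icc (0 : ℝ) 1 := ⟨measureReal_nonneg, measureReal_le_one⟩

variable {K x} in
lemma hitProb_of_mem (hx : x ∈ K) : hitProb N K x = 1 := by
  rw [hitProb, hitSet_of_mem hx, probReal_univ]

lemma totalRate_mul_real_returnSet :
    totalRate N * (jumpLaw N).real (returnSet K x) =
      (1 / 4) * ∑ e ∈ unitSteps, hitProb N K (x + e) := by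
  have hrate := totalRate_pos N
  rw [measureReal_def, jumpLaw_returnSet, ENNReal.toReal_sum fun e _ =>
    ENNReal.mul_ne_top ENNReal.ofReal_ne_top (measure_ne_top _ _)]
  simp only [ENNReal.toReal_mul, hitProb, measureReal_def]
  rw [ENNReal.toReal_ofReal (by positivity), ← Finset.mul_sum]
  field_simp

lemma hitProb_poisson :
    totalRate N * hitProb N K x - (1 / 4) * ∑ e ∈ unitSteps, hitProb N K (x + e)
      = equil N K x := by
  rw [← totalRate_mul_real_returnSet]
  by_cases hx : x ∈ K
  · rw [hitProb_of_mem N hx, equil, if_pos hx]; ring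
  · rw [equil_of_notMem N hx, hitProb, hitSet_of_notMem hx, sub_self]

end Equilibrium

lemma capN_coe_finset (N : ℝ) (K : Finset (ℤ × ℤ)) :
    capN N (K : Set (ℤ × ℤ)) = ENNReal.ofReal (∑ x ∈ K, equil N K x) := by
  rw [ENNReal.ofReal_sum_of_nonneg fun x _ => equil_nonneg _ _ _, capN,
    Finset.tsum_subtype' K (equilibrium N K)]
  refine Finset.sum_congr rfl fun x hx => ?_
  rw [equilibrium, walkLaw_returnTime, equil, if_pos (Finset.mem_coe.2 hx),
    ENNReal.ofReal_mul (totalRate_pos N).le,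
    ← probReal_compl_eq_one_sub measurableSet_returnSet, ofReal_measureReal]

/-! ### Positive semidefinite kernels -/

section PosSemidef

variable {α : Type*}

lemma posSemidef_of_sum_nonneg {G : Matrix α α ℝ} (hsymm : ∀ x y, G x y = G y x)
    (hG : ∀ (K : Finset α) (ν : α → ℝ), 0 ≤ ∑ x ∈ K, ∑ y ∈ K, ν x * ν y * G x y) :
    G.PosSemidef := by
  refine ⟨Matrix.IsHermitian.ext fun x y => hsymm y x, fun ν => ?_⟩
  refine (hG ν.support ν).trans_eq (Finset.sum_congr rfl fun x _ => Finset.sum_congr rfl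
    fun y _ => ?_)
  rw [star_trivial]
  ring

lemma sum_nonneg_of_posSemidef {G : Matrix α α ℝ} (hG : G.PosSemidef) (K : Finset α)
    (ν : α → ℝ) : 0 ≤ ∑ x ∈ K, ∑ y ∈ K, ν x * ν y * G x y := by
  have h := (hG.submatrix ((↑) : K → α)).dotProduct_mulVec_nonneg fun x => ν x
  simp only [dotProduct, Matrix.mulVec, Matrix.submatrix_apply, Finset.mul_sum,
    star_trivial] at h
  rw [← Finset.sum_coe_sort]
  refine h.trans_eq (Finset.sum_congr rfl fun x _ => ?_)
  rw [← Finset.sum_coe_sort K]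
  exact Finset.sum_congr rfl fun y _ => by ring

lemma posSemidef_mul_self (f : α → ℝ) : (Matrix.of fun x y => f x * f y).PosSemidef := by
  refine posSemidef_of_sum_nonneg (fun x y => mul_comm _ _) fun K ν => ?_
  calc 0 ≤ (∑ x ∈ K, ν x * f x) * ∑ y ∈ K, ν y * f y := mul_self_nonneg _
    _ = _ := by
      rw [Finset.sum_mul_sum]
      exact Finset.sum_congr rfl fun x _ => Finset.sum_congr rfl fun y _ => mul_mul_mul_comm _ _ _ _

lemma posSemidef_integral {T : Type*} [MeasurableSpace T] {μ : Measure T}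
    {G : T → Matrix α α ℝ} (hint : ∀ x y, Integrable (fun t => G t x y) μ)
    (hG : ∀ t, (G t).PosSemidef) : (Matrix.of fun x y => ∫ t, G t x y ∂μ).PosSemidef := by
  refine posSemidef_of_sum_nonneg
    (fun x y => integral_congr_ae (.of_forall fun t => ((hG t).isHermitian.apply x y).symm))
    fun K ν => ?_
  have hswap : ∑ x ∈ K, ∑ y ∈ K, ν x * ν y * ∫ t, G t x y ∂μ =
      ∫ t, ∑ x ∈ K, ∑ y ∈ K, ν x * ν y * G t x y ∂μ := by
    rw [integral_finsetSum _ fun x _ => integrable_finsetSum _ fun y _ => (hint x y).const_mul _]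
    refine Finset.sum_congr rfl fun x _ => ?_
    rw [integral_finsetSum _ fun y _ => (hint x y).const_mul _]
    exact Finset.sum_congr rfl fun y _ => (integral_const_mul _ _).symm
  exact hswap ▸ integral_nonneg fun t => sum_nonneg_of_posSemidef (hG t) K ν

lemma sq_sum_sum_le_of_posSemidef {G : Matrix α α ℝ} (hG : G.PosSemidef) (K : Finset α)
    (μ ν : α → ℝ) :
    (∑ x ∈ K, ∑ y ∈ K, μ x * ν y * G x y) ^ 2 ≤
      (∑ x ∈ K, ∑ y ∈ K, μ x * μ y * G x y) * ∑ x ∈ K, ∑ y ∈ K, ν x * ν y * G x y := by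
  set E : (α → ℝ) → (α → ℝ) → ℝ := fun μ ν => ∑ x ∈ K, ∑ y ∈ K, μ x * ν y * G x y with hE
  have hcomm : E μ ν = E ν μ := by
    refine Finset.sum_comm.trans ?_
    refine Finset.sum_congr rfl fun x _ => Finset.sum_congr rfl fun y _ => ?_
    rw [mul_comm (μ y), ← hG.isHermitian.apply x y, star_trivial]
  have hquad : ∀ s : ℝ, 0 ≤ E ν ν * (s * s) + 2 * E μ ν * s + E μ μ := by
    intro s
    refine (sum_nonneg_of_posSemidef hG K fun x => μ x + s * ν x).trans_eq ?_
    calc _ = s * s * E ν ν + s * E ν μ + s * E μ ν + E μ μ := by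
          simp only [hE, Finset.mul_sum, ← Finset.sum_add_distrib]
          exact Finset.sum_congr rfl fun x _ => Finset.sum_congr rfl fun y _ => by ring
      _ = _ := by rw [← hcomm]; ring
  linarith [discrim_le_zero hquad, show discrim (E ν ν) (2 * E μ ν) (E μ μ) =
    4 * (E μ ν ^ 2 - E μ μ * E ν ν) by unfold discrim; ring]

end PosSemidef

/-! ### The heat kernel of the walk on `ℤ` -/

/-- The characteristic function at `θ` of the walk on `ℤ` started at `0` that jumps to each
neighbour at rate `1/4`, at time `t`. -/
def walkChar (t θ : ℝ) : ℝ := Real.exp (-(t / 2) * (1 - Real.cos θ))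

/-- The probability that the walk on `ℤ` started at `0` that jumps to each neighbour at rate `1/4`
is at `k` at time `t`, as the Fourier inverse of `walkChar`. -/
def heat (t : ℝ) (k : ℤ) : ℝ :=
  (2 * Real.pi)⁻¹ * ∫ θ in (-Real.pi)..Real.pi, Real.cos (k * θ) * walkChar t θ

@[fun_prop]
lemma continuous_walkChar (t : ℝ) : Continuous (walkChar t) := by
  unfold walkChar
  fun_prop

lemma walkChar_pos (t θ : ℝ) : 0 < walkChar t θ := Real.exp_pos _

lemma walkChar_le_one {t : ℝ} (ht : 0 ≤ t) (θ : ℝ) : walkChar t θ ≤ 1 :=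
  Real.exp_le_one_iff.2 (mul_nonpos_of_nonpos_of_nonneg (by linarith)
    (sub_nonneg.2 (Real.cos_le_one θ)))

lemma walkChar_le_exp_abs (t θ : ℝ) : walkChar t θ ≤ Real.exp |t| := by
  refine Real.exp_le_exp.2 ?_
  nlinarith [neg_abs_le t, abs_nonneg t, Real.cos_le_one θ, Real.neg_one_le_cos θ]

lemma hasDerivAt_walkChar (t θ : ℝ) :
    HasDerivAt (fun s => walkChar s θ) (walkChar t θ * (-(1 / 2) * (1 - Real.cos θ))) t :=
  (((hasDerivAt_id t).div_const 2).fun_neg.mul_const (1 - Real.cos θ)).exp.congr_deriv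
    (by simp only [walkChar, id])

lemma intervalIntegrable_cos_mul_walkChar (t : ℝ) (k : ℤ) (a b : ℝ) :
    IntervalIntegrable (fun θ => Real.cos (k * θ) * walkChar t θ) volume a b :=
  (by fun_prop : Continuous _).intervalIntegrable _ _

lemma heat_neg (t : ℝ) (k : ℤ) : heat t (-k) = heat t k := by
  simp [heat]

lemma heat_zero (k : ℤ) : heat 0 k = if k = 0 then 1 else 0 := by
  have hchar : ∀ θ, walkChar 0 θ = 1 := fun θ => by simp [walkChar]
  simp only [heat, hchar, mul_one]
  split_ifs with hk
  · rw [hk, Int.cast_zero]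
    simp only [zero_mul, Real.cos_zero, intervalIntegral.integral_const, smul_eq_mul]
    field_simp
    ring
  · have hk' : (k : ℝ) ≠ 0 := Int.cast_ne_zero.2 hk
    simp [intervalIntegral.integral_comp_mul_left Real.cos hk', Real.sin_int_mul_pi]

lemma abs_heat_le_one {t : ℝ} (ht : 0 ≤ t) (k : ℤ) : |heat t k| ≤ 1 := by
  have hbound : ∀ θ ∈ uIoc (-Real.pi) Real.pi, ‖Real.cos (k * θ) * walkChar t θ‖ ≤ 1 := by
    intro θ _
    rw [norm_mul, Real.norm_eq_abs, Real.norm_of_nonneg (walkChar_pos t θ).le]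
    exact mul_le_one₀ (Real.abs_cos_le_one _) (walkChar_pos t θ).le (walkChar_le_one ht θ)
  have hint := intervalIntegral.norm_integral_le_of_norm_le_const hbound
  have hpi := Real.pi_pos
  rw [Real.norm_eq_abs, abs_of_pos (by linarith : 0 < Real.pi - -Real.pi)] at hint
  rw [heat, abs_mul, abs_of_pos (by positivity)]
  calc _ ≤ (2 * Real.pi)⁻¹ * (1 * (Real.pi - -Real.pi)) := by gcongr
    _ = 1 := by field_simp; ring

lemma hasDerivAt_integral_cos_mul_walkChar (t : ℝ) (k : ℤ) (a b : ℝ) :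
    HasDerivAt (fun s => ∫ θ in a..b, Real.cos (k * θ) * walkChar s θ)
      (∫ θ in a..b, Real.cos (k * θ) * (walkChar t θ * (-(1 / 2) * (1 - Real.cos θ)))) t := by
  refine (intervalIntegral.hasDerivAt_integral_of_dominated_loc_of_deriv_le
    (bound := fun _ => Real.exp (|t| + 1)) (Metric.ball_mem_nhds t one_pos)
    (.of_forall fun s => (by fun_prop : Continuous _).aestronglyMeasurable)
    (intervalIntegrable_cos_mul_walkChar t k a b)
    (by fun_prop : Continuous _).aestronglyMeasurable
    (.of_forall fun θ _ s hs => ?_) intervalIntegrable_const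
    (.of_forall fun θ _ s _ => (hasDerivAt_walkChar s θ).const_mul _)).2
  have hs' : |s| ≤ |t| + 1 := by
    rw [Metric.mem_ball, Real.dist_eq] at hs
    linarith [abs_sub_abs_le_abs_sub s t]
  have hcos : |(-(1 / 2) * (1 - Real.cos θ))| ≤ 1 :=
    abs_le.2 ⟨by linarith [Real.neg_one_le_cos θ], by linarith [Real.cos_le_one θ]⟩
  rw [norm_mul, norm_mul, Real.norm_of_nonneg (walkChar_pos s θ).le]
  calc _ ≤ 1 * (Real.exp (|t| + 1) * 1) := by
        gcongr
        · exact mul_nonneg (walkChar_pos s θ).le (norm_nonneg _)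
        · exact Real.abs_cos_le_one _
        · exact (walkChar_le_exp_abs s θ).trans (Real.exp_le_exp.2 hs')
        · exact hcos
    _ = _ := by ring

lemma hasDerivAt_heat (t : ℝ) (k : ℤ) :
    HasDerivAt (fun s => heat s k)
      (1 / 4 * (heat t (k - 1) + heat t (k + 1)) - 1 / 2 * heat t k) t := by
  refine ((hasDerivAt_integral_cos_mul_walkChar t k (-Real.pi) Real.pi).const_mul
    (2 * Real.pi)⁻¹).congr_deriv ?_
  have hcos : ∀ θ : ℝ, Real.cos ((k - 1 : ℤ) * θ) + Real.cos ((k + 1 : ℤ) * θ) =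
      2 * (Real.cos (k * θ) * Real.cos θ) := fun θ => by
    push_cast
    rw [sub_mul, add_mul, one_mul, Real.cos_sub, Real.cos_add]
    ring
  have hint := fun j => intervalIntegrable_cos_mul_walkChar t j (-Real.pi) Real.pi
  have hintegral : ∫ θ in (-Real.pi)..Real.pi, Real.cos (k * θ) *
        (walkChar t θ * (-(1 / 2) * (1 - Real.cos θ))) =
      1 / 4 * ((∫ θ in (-Real.pi)..Real.pi, Real.cos ((k - 1 : ℤ) * θ) * walkChar t θ) +
        ∫ θ in (-Real.pi)..Real.pi, Real.cos ((k + 1 : ℤ) * θ) * walkChar t θ) -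
      1 / 2 * ∫ θ in (-Real.pi)..Real.pi, Real.cos (k * θ) * walkChar t θ := by
    rw [← intervalIntegral.integral_add (hint _) (hint _), ← intervalIntegral.integral_const_mul,
      ← intervalIntegral.integral_const_mul, ← intervalIntegral.integral_sub
        (((hint _).add (hint _)).const_mul _) ((hint _).const_mul _)]
    refine intervalIntegral.integral_congr fun θ _ => ?_
    linear_combination (-(1 / 4) * walkChar t θ) * hcos θ
  rw [hintegral]
  simp only [heat]
  ring

@[fun_prop]
lemma continuous_heat (k : ℤ) : Continuous fun t => heat t k :=
  continuous_iff_continuousAt.2 fun t => (hasDerivAt_heat t k).continuousAt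

lemma posSemidef_heat (t : ℝ) : (Matrix.of fun j k : ℤ => heat t (j - k)).PosSemidef := by
  let G : ℝ → Matrix ℤ ℤ ℝ := fun θ => ((2 * Real.pi)⁻¹ * walkChar t θ) •
    (Matrix.of (fun j k : ℤ => Real.cos (j * θ) * Real.cos (k * θ)) +
      Matrix.of fun j k : ℤ => Real.sin (j * θ) * Real.sin (k * θ))
  have hG : ∀ θ, (G θ).PosSemidef := fun θ =>
    ((posSemidef_mul_self _).add (posSemidef_mul_self _)).smul
      (mul_nonneg (by positivity) (walkChar_pos t θ).le)
  have happly : ∀ θ j k, G θ j k =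
      (2 * Real.pi)⁻¹ * (Real.cos ((j - k : ℤ) * θ) * walkChar t θ) := fun θ j k => by
    simp only [G, Matrix.smul_apply, Matrix.add_apply, Matrix.of_apply, smul_eq_mul]
    push_cast
    rw [sub_mul, Real.cos_sub]
    ring
  have hheat : ∀ j k : ℤ, heat t (j - k) = ∫ θ in Ioc (-Real.pi) Real.pi, G θ j k := fun j k => by
    simp only [happly, integral_const_mul]
    rw [heat, intervalIntegral.integral_of_le (by linarith [Real.pi_pos])]
  simp only [hheat]
  refine posSemidef_integral (fun j k => ?_) hG
  simp only [happly]
  exact ((intervalIntegrable_cos_mul_walkChar t (j - k) _ _).1).const_mul _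

/-! ### The Green function of the killed walk -/

/-- The probability that the killed walk on `ℤ²` started at `0` is at `x` at time `t`: before it is
killed, its two coordinates are independent walks on `ℤ`. -/
def killedHeat (N t : ℝ) (x : ℤ × ℤ) : ℝ :=
  Real.exp (-(N ^ 2)⁻¹ * t) * (heat t x.1 * heat t x.2)

/-- The Green function of the killed walk on `ℤ²`. -/
def green (N : ℝ) (x : ℤ × ℤ) : ℝ := ∫ t in Ioi (0 : ℝ), killedHeat N t x

lemma killedHeat_zero (N : ℝ) (x : ℤ × ℤ) : killedHeat N 0 x = if x = 0 then 1 else 0 := by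
  by_cases h₁ : x.1 = 0 <;> by_cases h₂ : x.2 = 0 <;>
    simp [killedHeat, heat_zero, Prod.ext_iff, h₁, h₂]

@[fun_prop]
lemma continuous_killedHeat (N : ℝ) (x : ℤ × ℤ) : Continuous fun t => killedHeat N t x := by
  unfold killedHeat
  fun_prop

lemma abs_killedHeat_le (N : ℝ) {t : ℝ} (ht : 0 ≤ t) (x : ℤ × ℤ) :
    |killedHeat N t x| ≤ Real.exp (-(N ^ 2)⁻¹ * t) := by
  rw [killedHeat, abs_mul, Real.abs_exp, abs_mul]
  exact mul_le_of_le_one_right (Real.exp_pos _).le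
    (mul_le_one₀ (abs_heat_le_one ht _) (abs_nonneg _) (abs_heat_le_one ht _))

lemma sum_unitSteps {M : Type*} [AddCommMonoid M] (f : ℤ × ℤ → M) :
    ∑ e ∈ unitSteps, f e = f (1, 0) + (f (-1, 0) + (f (0, 1) + f (0, -1))) := by
  rw [unitSteps, Finset.sum_insert (by decide), Finset.sum_insert (by decide),
    Finset.sum_insert (by decide), Finset.sum_singleton]

lemma hasDerivAt_killedHeat (N t : ℝ) (x : ℤ × ℤ) :
    HasDerivAt (fun s => killedHeat N s x)
      ((1 / 4) * ∑ e ∈ unitSteps, killedHeat N t (x + e) - totalRate N * killedHeat N t x) t := by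
  have hexp : HasDerivAt (fun s => Real.exp (-(N ^ 2)⁻¹ * s))
      (Real.exp (-(N ^ 2)⁻¹ * t) * -(N ^ 2)⁻¹) t := by
    simpa using ((hasDerivAt_id t).const_mul (-(N ^ 2)⁻¹)).exp
  refine (hexp.mul ((hasDerivAt_heat t x.1).mul (hasDerivAt_heat t x.2))).congr_deriv ?_
  simp only [sum_unitSteps, killedHeat, totalRate, Prod.fst_add, Prod.snd_add, add_zero,
    ← sub_eq_add_neg, Pi.mul_apply]
  ring

lemma green_neg (N : ℝ) (x : ℤ × ℤ) : green N (-x) = green N x := by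
  simp [green, killedHeat, heat_neg]

section Green

variable {N : ℝ} (hN : 0 < N)
include hN

lemma integrableOn_exp_killing : IntegrableOn (fun t => Real.exp (-(N ^ 2)⁻¹ * t)) (Ioi 0) :=
  exp_neg_integrableOn_Ioi 0 (by positivity)

lemma integrableOn_killedHeat (x : ℤ × ℤ) :
    IntegrableOn (fun t => killedHeat N t x) (Ioi 0) := by
  refine (integrableOn_exp_killing hN).mono'
    (continuous_killedHeat N x).aestronglyMeasurable ?_
  filter_upwards [ae_restrict_mem measurableSet_Ioi] with t ht
  exact abs_killedHeat_le N (le_of_lt ht) x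

lemma abs_green_le (x : ℤ × ℤ) :
    |green N x| ≤ ∫ t in Ioi (0 : ℝ), Real.exp (-(N ^ 2)⁻¹ * t) := by
  rw [← Real.norm_eq_abs, green]
  refine norm_integral_le_of_norm_le (integrableOn_exp_killing hN) ?_
  filter_upwards [ae_restrict_mem measurableSet_Ioi] with t ht
  exact abs_killedHeat_le N (le_of_lt ht) x

lemma tendsto_killedHeat_atTop (x : ℤ × ℤ) :
    Filter.Tendsto (fun t => killedHeat N t x) Filter.atTop (nhds 0) := by
  have hexp : Filter.Tendsto (fun t : ℝ => Real.exp (-(N ^ 2)⁻¹ * t)) Filter.atTop (nhds 0) :=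
    Real.tendsto_exp_atBot.comp
      (Filter.tendsto_id.const_mul_atTop_of_neg (neg_neg_of_pos (by positivity)))
  refine squeeze_zero_norm' ?_ hexp
  filter_upwards [Filter.eventually_ge_atTop 0] with t ht using abs_killedHeat_le N ht x

lemma green_poisson (x : ℤ × ℤ) :
    totalRate N * green N x - (1 / 4) * ∑ e ∈ unitSteps, green N (x + e)
      = if x = 0 then 1 else 0 := by
  have hint := integrableOn_killedHeat hN
  have hsum : IntegrableOn (fun t => ∑ e ∈ unitSteps, killedHeat N t (x + e)) (Ioi 0) :=
    integrable_finsetSum _ fun e _ => hint _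
  have hgreen : ∫ t in Ioi (0 : ℝ), ((1 / 4) * ∑ e ∈ unitSteps, killedHeat N t (x + e) -
      totalRate N * killedHeat N t x) =
      (1 / 4) * ∑ e ∈ unitSteps, green N (x + e) - totalRate N * green N x := by
    rw [integral_sub (hsum.const_mul _) ((hint x).const_mul _), integral_const_mul,
      integral_const_mul, integral_finsetSum _ fun e _ => hint _]
    rfl
  have hftc := integral_Ioi_of_hasDerivAt_of_tendsto'
    (fun t _ => hasDerivAt_killedHeat N t x) ((hsum.const_mul _).sub ((hint x).const_mul _))
    (tendsto_killedHeat_atTop hN x)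
  rw [hgreen, killedHeat_zero] at hftc
  linarith

lemma posSemidef_green : (Matrix.of fun x y : ℤ × ℤ => green N (x - y)).PosSemidef := by
  refine posSemidef_integral (G := fun t => Matrix.of fun x y : ℤ × ℤ => killedHeat N t (x - y))
    (fun x y => integrableOn_killedHeat hN (x - y)) fun t => ?_
  exact (((posSemidef_heat t).submatrix Prod.fst).hadamard
    ((posSemidef_heat t).submatrix Prod.snd)).smul (Real.exp_pos (-(N ^ 2)⁻¹ * t)).le

/-! ### The equilibrium measure and the capacity -/

lemma eq_zero_of_bounded_of_poisson {u : ℤ × ℤ → ℝ} {B : ℝ} (hB : ∀ x, |u x| ≤ B)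
    (hu : ∀ x, totalRate N * u x - (1 / 4) * ∑ e ∈ unitSteps, u (x + e) = 0) (x : ℤ × ℤ) :
    u x = 0 := by
  have hle : ∀ x, |u x| ≤ ⨆ x, |u x| := le_ciSup ⟨B, forall_mem_range.2 hB⟩
  set s := ⨆ x, |u x|
  have hrate : 1 < totalRate N := lt_add_of_pos_right 1 (by positivity)
  have hrate₀ := totalRate_pos N
  have hcontract : ∀ x, |u x| ≤ s / totalRate N := by
    intro x
    have hcard : unitSteps.card = 4 := rfl
    rw [le_div_iff₀ hrate₀, mul_comm, ← abs_of_pos hrate₀, ← abs_mul, sub_eq_zero.1 (hu x),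
      abs_mul, abs_of_pos (by norm_num : (0 : ℝ) < 1 / 4)]
    calc (1 / 4) * |∑ e ∈ unitSteps, u (x + e)|
        ≤ (1 / 4) * ∑ _e ∈ unitSteps, s := by
          gcongr
          exact (Finset.abs_sum_le_sum_abs _ _).trans (Finset.sum_le_sum fun _ _ => hle _)
      _ = s := by rw [Finset.sum_const, hcard, nsmul_eq_mul]; push_cast; ring
  have hs : s ≤ s / totalRate N := ciSup_le hcontract
  rw [le_div_iff₀ hrate₀] at hs
  exact abs_nonpos_iff.1 ((hle x).trans (by nlinarith))

lemma sum_green_mul_poisson (K : Finset (ℤ × ℤ)) (f : ℤ × ℤ → ℝ) (x : ℤ × ℤ) :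
    totalRate N * ∑ y ∈ K, green N (x - y) * f y -
      (1 / 4) * ∑ e ∈ unitSteps, ∑ y ∈ K, green N (x + e - y) * f y =
        if x ∈ K then f x else 0 := by
  rw [Finset.sum_comm, Finset.mul_sum, Finset.mul_sum, ← Finset.sum_sub_distrib,
    ← Finset.sum_ite_eq K x f]
  refine Finset.sum_congr rfl fun y _ => ?_
  have hpoisson := green_poisson hN (x - y)
  simp only [sub_eq_zero, sub_add_eq_add_sub] at hpoisson
  rw [← Finset.sum_mul]
  split_ifs at hpoisson ⊢ <;> linear_combination f y * hpoisson

variable (K : Finset (ℤ × ℤ))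

lemma sum_green_mul_equil (x : ℤ × ℤ) :
    ∑ y ∈ K, green N (x - y) * equil N K y = hitProb N K x := by
  set g := ∫ t in Ioi (0 : ℝ), Real.exp (-(N ^ 2)⁻¹ * t)
  have hbounded : ∀ x, |∑ y ∈ K, green N (x - y) * equil N K y - hitProb N K x| ≤
      ∑ y ∈ K, g * equil N K y + 1 := by
    intro x
    refine (abs_sub _ _).trans (add_le_add ?_ ?_)
    · refine (Finset.abs_sum_le_sum_abs _ _).trans (Finset.sum_le_sum fun y _ => ?_)
      rw [abs_mul, abs_of_nonneg (equil_nonneg N K y)]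
      exact mul_le_mul_of_nonneg_right (abs_green_le hN _) (equil_nonneg N K y)
    · obtain ⟨hpos, hle⟩ := hitProb_mem_Icc N K x
      rwa [abs_of_nonneg hpos]
  refine sub_eq_zero.1 (eq_zero_of_bounded_of_poisson hN hbounded (fun x => ?_) x)
  have hsource : (if x ∈ K then equil N K x else 0) = equil N K x :=
    ite_eq_left_iff.2 fun hx => (equil_of_notMem N (mt Finset.mem_coe.1 hx)).symm
  have hpotential := sum_green_mul_poisson hN K (equil N K) x
  rw [hsource, ← hitProb_poisson] at hpotential
  rw [Finset.sum_sub_distrib]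
  linarith

lemma sum_sum_mul_equil_mul_green (ν : ℤ × ℤ → ℝ) :
    ∑ x ∈ K, ∑ y ∈ K, ν x * equil N K y * green N (x - y) = ∑ x ∈ K, ν x := by
  refine Finset.sum_congr rfl fun x hx => ?_
  calc ∑ y ∈ K, ν x * equil N K y * green N (x - y)
      = ν x * ∑ y ∈ K, green N (x - y) * equil N K y := by
        rw [Finset.mul_sum]
        exact Finset.sum_congr rfl fun y _ => by ring
    _ = ν x := by
        rw [sum_green_mul_equil hN, hitProb_of_mem N (Finset.mem_coe.2 hx), mul_one]

lemma sq_sum_le_energy_mul_sum_equil (ν : ℤ × ℤ → ℝ) :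
    (∑ x ∈ K, ν x) ^ 2 ≤
      (∑ x ∈ K, ∑ y ∈ K, ν x * ν y * green N (x - y)) * ∑ x ∈ K, equil N K x := by
  have h := sq_sum_sum_le_of_posSemidef (posSemidef_green hN) K ν (equil N K)
  simpa only [Matrix.of_apply, sum_sum_mul_equil_mul_green hN] using h

end Green

/-! ### The Green function of killed Brownian motion -/

/-- The density at distance `r` from the origin of planar Brownian motion with variance `1/2` per
coordinate at time `1`, run for time `t`. -/
def planarGauss (t r : ℝ) : ℝ := (Real.pi * t)⁻¹ * Real.exp (-r ^ 2 / t)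

/-- The Green function `(2/π) K₀(2r)` at distance `r` of planar Brownian motion with variance `1/2`
per coordinate at time `1`, killed at rate one. It takes the junk value `0` at `r = 0`. -/
def brownianGreen (r : ℝ) : ℝ := ∫ t in Ioi (0 : ℝ), Real.exp (-t) * planarGauss t r

@[fun_prop]
lemma measurable_planarGauss (r : ℝ) : Measurable fun t => planarGauss t r := by
  unfold planarGauss
  fun_prop

lemma planarGauss_pos {t : ℝ} (ht : 0 < t) (r : ℝ) : 0 < planarGauss t r :=
  mul_pos (inv_pos.2 (mul_pos Real.pi_pos ht)) (Real.exp_pos _)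

lemma planarGauss_le_inv {t : ℝ} (ht : 0 < t) (r : ℝ) : planarGauss t r ≤ t⁻¹ := by
  have hexp : Real.exp (-r ^ 2 / t) ≤ 1 := by
    rw [neg_div]
    exact Real.exp_le_one_iff.2 (neg_nonpos.2 (by positivity))
  refine (mul_le_of_le_one_right (by positivity) hexp).trans ?_
  gcongr
  exact le_mul_of_one_le_left ht.le (by linarith [Real.pi_gt_three])

lemma planarGauss_le_inv_sq {r t : ℝ} (hr : 0 < r) (ht : 0 < t) :
    planarGauss t r ≤ (r ^ 2)⁻¹ := by
  have hexp : Real.exp (-r ^ 2 / t) ≤ (r ^ 2 / t)⁻¹ := by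
    rw [neg_div, Real.exp_neg]
    gcongr
    linarith [Real.add_one_le_exp (r ^ 2 / t)]
  have hpi : (Real.pi * t)⁻¹ ≤ t⁻¹ := by
    gcongr
    exact le_mul_of_one_le_left ht.le (by linarith [Real.pi_gt_three])
  calc planarGauss t r ≤ t⁻¹ * (r ^ 2 / t)⁻¹ := by unfold planarGauss; gcongr
    _ = (r ^ 2)⁻¹ := by field_simp

lemma integrableOn_exp_mul_planarGauss {r a : ℝ} (hr : 0 < r) (ha : 0 < a) :
    IntegrableOn (fun t => Real.exp (-a * t) * planarGauss t r) (Ioi 0) := by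
  refine ((exp_neg_integrableOn_Ioi 0 ha).mul_const (r ^ 2)⁻¹).mono'
    (by fun_prop : Measurable _).aestronglyMeasurable ?_
  filter_upwards [ae_restrict_mem measurableSet_Ioi] with t ht
  rw [Real.norm_of_nonneg (mul_pos (Real.exp_pos _) (planarGauss_pos ht r)).le]
  exact mul_le_mul_of_nonneg_left (planarGauss_le_inv_sq hr ht) (Real.exp_pos _).le

/-- Brownian scaling turns the scale of the distance into the killing rate. -/
lemma brownianGreen_mul {b : ℝ} (hb : 0 < b) (r : ℝ) : brownianGreen (b * r) =
    ∫ t in Ioi (0 : ℝ), Real.exp (-b ^ 2 * t) * planarGauss t r := by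
  have hscale := integral_comp_mul_left_Ioi (fun t => Real.exp (-t) * planarGauss t (b * r)) 0
    (b := b ^ 2) (by positivity)
  rw [mul_zero, smul_eq_mul, inv_mul_eq_div, eq_div_iff (by positivity)] at hscale
  rw [brownianGreen, ← hscale, mul_comm, ← integral_const_mul]
  refine setIntegral_congr_fun measurableSet_Ioi fun t (ht : 0 < t) => ?_
  have hexponent : -(b * r) ^ 2 / (b ^ 2 * t) = -r ^ 2 / t := by field_simp
  simp only [planarGauss, hexponent, neg_mul]
  field_simp

lemma integrableOn_brownianGreen {r : ℝ} (hr : 0 < r) :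
    IntegrableOn (fun t => Real.exp (-t) * planarGauss t r) (Ioi 0) := by
  simpa using integrableOn_exp_mul_planarGauss hr one_pos

lemma exp_mul_planarGauss_nonneg (r : ℝ) :
    ∀ᵐ t ∂volume.restrict (Ioi (0 : ℝ)), 0 ≤ Real.exp (-t) * planarGauss t r := by
  filter_upwards [ae_restrict_mem measurableSet_Ioi] with t ht
  exact (mul_pos (Real.exp_pos _) (planarGauss_pos ht r)).le

lemma brownianGreen_nonneg (r : ℝ) : 0 ≤ brownianGreen r :=
  integral_nonneg_of_ae (exp_mul_planarGauss_nonneg r)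

lemma brownianGreen_pos {r : ℝ} (hr : 0 < r) : 0 < brownianGreen r := by
  refine (setIntegral_pos_iff_support_of_nonneg_ae (exp_mul_planarGauss_nonneg r)
    (integrableOn_brownianGreen hr)).2 ?_
  have hsupport : Ioi (0 : ℝ) ⊆
      (Function.support fun t => Real.exp (-t) * planarGauss t r) ∩ Ioi 0 :=
    fun t ht => ⟨(mul_pos (Real.exp_pos _) (planarGauss_pos ht r)).ne', ht⟩
  exact (by simp : 0 < volume (Ioi (0 : ℝ))).trans_le (measure_mono hsupport)

lemma antitoneOn_brownianGreen : AntitoneOn brownianGreen (Ioi 0) := by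
  intro r (hr : 0 < r) s hs hrs
  refine setIntegral_mono_on (integrableOn_brownianGreen hs) (integrableOn_brownianGreen hr)
    measurableSet_Ioi fun t (ht : 0 < t) => ?_
  unfold planarGauss
  gcongr

lemma one_sub_exp_neg_le_rpow {y p : ℝ} (hy : 0 ≤ y) (hp₀ : 0 ≤ p) (hp₁ : p ≤ 1) :
    1 - Real.exp (-y) ≤ y ^ p := by
  rcases le_total y 1 with hy₁ | hy₁
  · calc 1 - Real.exp (-y) ≤ y := by linarith [Real.add_one_le_exp (-y)]
      _ = y ^ (1 : ℝ) := (Real.rpow_one y).symm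
      _ ≤ y ^ p := Real.rpow_le_rpow_of_exponent_ge' hy hy₁ hp₀ hp₁
  · linarith [Real.exp_pos (-y), Real.one_le_rpow hy₁ hp₀]

lemma brownianGreen_sub_le {r a p : ℝ} (hr : 0 < r) (ha : 1 ≤ a) (hp₀ : 0 < p) (hp₁ : p ≤ 1) :
    brownianGreen r - brownianGreen (a * r) ≤ (a ^ 2 - 1) ^ p * Real.Gamma p := by
  have ha₀ : 0 < a := one_pos.trans_le ha
  have ha₂ : 0 ≤ a ^ 2 - 1 := sub_nonneg.2 (one_le_pow₀ ha)
  have hint := integrableOn_exp_mul_planarGauss hr (a := a ^ 2) (by positivity)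
  rw [brownianGreen_mul ha₀, brownianGreen, ← integral_sub (integrableOn_brownianGreen hr) hint,
    Real.Gamma_eq_integral hp₀, ← integral_const_mul]
  refine setIntegral_mono_on ((integrableOn_brownianGreen hr).sub hint)
    ((Real.GammaIntegral_convergent hp₀).const_mul _) measurableSet_Ioi fun t (ht : 0 < t) => ?_
  have hfactor : Real.exp (-a ^ 2 * t) = Real.exp (-t) * Real.exp (-((a ^ 2 - 1) * t)) := by
    rw [← Real.exp_add]
    ring_nf
  have hy : 0 ≤ (a ^ 2 - 1) * t := mul_nonneg ha₂ ht.le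
  calc Real.exp (-t) * planarGauss t r - Real.exp (-a ^ 2 * t) * planarGauss t r
      = Real.exp (-t) * ((1 - Real.exp (-((a ^ 2 - 1) * t))) * planarGauss t r) := by
        rw [hfactor]
        ring
    _ ≤ Real.exp (-t) * (((a ^ 2 - 1) * t) ^ p * t⁻¹) := by
        gcongr
        · exact (planarGauss_pos ht r).le
        · exact one_sub_exp_neg_le_rpow hy hp₀.le hp₁
        · exact planarGauss_le_inv ht r
    _ = (a ^ 2 - 1) ^ p * (Real.exp (-t) * t ^ (p - 1)) := by
        rw [Real.mul_rpow ha₂ ht.le, Real.rpow_sub_one ht.ne']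
        ring

lemma mul_neg_log_le_brownianGreen {r : ℝ} (hr : 0 < r) (hr₁ : r ≤ 1) :
    Real.pi⁻¹ * Real.exp (-2) * (-Real.log (r ^ 2)) ≤ brownianGreen r := by
  have hr₂ : 0 < r ^ 2 := by positivity
  have hr₂₁ : r ^ 2 ≤ 1 := pow_le_one₀ hr.le hr₁
  have hsubset : Ioc (r ^ 2) 1 ⊆ Ioi 0 := fun t ht => hr₂.trans ht.1
  have hinv : IntegrableOn (fun t : ℝ => Real.pi⁻¹ * Real.exp (-2) * (1 / t)) (Ioc (r ^ 2) 1) := by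
    have hcont : ContinuousOn (fun t : ℝ => Real.pi⁻¹ * Real.exp (-2) * (1 / t))
        (Icc (r ^ 2) 1) :=
      continuousOn_const.mul (continuousOn_const.div continuousOn_id
        fun t ht => (hr₂.trans_le ht.1).ne')
    exact hcont.integrableOn_Icc.mono_set Ioc_subset_Icc_self
  calc Real.pi⁻¹ * Real.exp (-2) * (-Real.log (r ^ 2))
      = ∫ t in Ioc (r ^ 2) 1, Real.pi⁻¹ * Real.exp (-2) * (1 / t) := by
        rw [← intervalIntegral.integral_of_le hr₂₁, intervalIntegral.integral_const_mul,
          integral_one_div_of_pos hr₂ one_pos, one_div, Real.log_inv]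
    _ ≤ ∫ t in Ioc (r ^ 2) 1, Real.exp (-t) * planarGauss t r := by
        refine setIntegral_mono_on hinv ((integrableOn_brownianGreen hr).mono_set hsubset)
          measurableSet_Ioc fun t ht => ?_
        have ht₀ : 0 < t := hsubset ht
        have hexp : Real.exp (-2) ≤ Real.exp (-t) * Real.exp (-r ^ 2 / t) := by
          rw [← Real.exp_add, neg_div]
          exact Real.exp_le_exp.2 (by linarith [ht.2, (div_le_one ht₀).2 ht.1.le])
        calc Real.pi⁻¹ * Real.exp (-2) * (1 / t) = (Real.pi * t)⁻¹ * Real.exp (-2) := by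
              field_simp
          _ ≤ (Real.pi * t)⁻¹ * (Real.exp (-t) * Real.exp (-r ^ 2 / t)) := by gcongr
          _ = Real.exp (-t) * planarGauss t r := mul_left_comm _ _ _
    _ ≤ brownianGreen r :=
        setIntegral_mono_set (integrableOn_brownianGreen hr) (exp_mul_planarGauss_nonneg r)
          hsubset.eventuallyLE

lemma tendsto_brownianGreen_nhdsGT_zero :
    Filter.Tendsto brownianGreen (𝓝[>] 0) Filter.atTop := by
  have hlog : Filter.Tendsto (fun r : ℝ => Real.pi⁻¹ * Real.exp (-2) * (-Real.log (r ^ 2)))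
      (𝓝[>] 0) Filter.atTop := by
    simp only [Real.log_pow]
    exact (Filter.tendsto_neg_atBot_atTop.comp (Real.tendsto_log_nhdsGT_zero.const_mul_atBot
      (by norm_num))).const_mul_atTop (by have := Real.pi_pos; positivity)
  refine Filter.tendsto_atTop_mono' _ ?_ hlog
  filter_upwards [Ioc_mem_nhdsGT one_pos] with r hr
  exact mul_neg_log_le_brownianGreen hr.1 hr.2

lemma exists_forall_le_brownianGreen (B : ℝ) :
    ∃ η > 0, ∀ r, 0 < r → r ≤ η → B ≤ brownianGreen r := by
  obtain ⟨η, hη, hsubset⟩ := mem_nhdsGT_iff_exists_Ioc_subset.1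
    (tendsto_brownianGreen_nhdsGT_zero.eventually_ge_atTop B)
  exact ⟨η, hη, fun r hr hrη => hsubset ⟨hr, hrη⟩⟩

lemma exists_brownianGreen_le_mul {ε a b : ℝ} (hε : 0 < ε) (ha : 0 < a) (hb : 0 < b) :
    ∃ η > 0, ∀ r s, 0 < r → r ≤ s → s ≤ b * r → s ≤ r + η → s ≤ a →
      brownianGreen r ≤ (1 + ε) * brownianGreen s := by
  obtain ⟨ζ, hζ, hζle⟩ := exists_forall_le_brownianGreen (b ^ 2 / ε)
  have hGa := brownianGreen_pos ha
  refine ⟨ε * brownianGreen a * (ζ / b) ^ 2 / (2 * a), by positivity,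
    fun r s hr hrs hsb hsη hsa => ?_⟩
  have hs : 0 < s := hr.trans_le hrs
  have hdiff : brownianGreen r - brownianGreen s ≤ (s / r) ^ 2 - 1 := by
    simpa [div_mul_cancel₀ s hr.ne'] using
      brownianGreen_sub_le hr ((one_le_div hr).2 hrs) one_pos le_rfl
  suffices (s / r) ^ 2 - 1 ≤ ε * brownianGreen s by linarith
  rcases le_total s ζ with hsζ | hζs
  · have hGs := hζle s hs hsζ
    have hsr : (s / r) ^ 2 ≤ b ^ 2 := by
      gcongr
      exact (div_le_iff₀ hr).2 hsb
    rw [div_le_iff₀ hε] at hGs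
    linarith
  · have hζr : ζ / b ≤ r := (div_le_iff₀' hb).2 (hζs.trans hsb)
    calc (s / r) ^ 2 - 1 = (s - r) * (s + r) / r ^ 2 := by field_simp; ring
      _ ≤ ε * brownianGreen a * (ζ / b) ^ 2 / (2 * a) * (2 * a) / (ζ / b) ^ 2 := by
          gcongr <;> linarith
      _ = ε * brownianGreen a := by field_simp
      _ ≤ ε * brownianGreen s := by
          gcongr
          exact antitoneOn_brownianGreen hs ha hsa

/-- The kernel of the Brownian energy. It agrees with `brownianGreen` at positive distances, and is
infinite at `0`. -/
def energyKernel (r : ℝ) : ℝ≥0∞ := ENNReal.ofReal (2 / Real.pi) * besselK0 (2 * r)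

lemma energyKernel_eq {r : ℝ} (hr : 0 < r) :
    energyKernel r = ENNReal.ofReal (brownianGreen r) := by
  rw [energyKernel, besselK0, brownianGreen, ofReal_integral_eq_lintegral_ofReal
    (integrableOn_brownianGreen hr) (exp_mul_planarGauss_nonneg r),
    ← lintegral_const_mul _ (by fun_prop)]
  refine setLIntegral_congr_fun measurableSet_Ioi fun t (ht : 0 < t) => ?_
  have hexponent : -(2 * r) ^ 2 / (4 * t) - t = -t + -r ^ 2 / t := by
    field_simp
    ring
  rw [← ENNReal.ofReal_mul (by positivity), hexponent, Real.exp_add, planarGauss]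
  congr 1
  field_simp

@[fun_prop]
lemma measurable_energyKernel : Measurable energyKernel := by
  unfold energyKernel besselK0
  exact (Measurable.lintegral_prod_right' (f := fun p : ℝ × ℝ => ENNReal.ofReal
    (1 / (2 * p.2) * Real.exp (-(2 * p.1) ^ 2 / (4 * p.2) - p.2))) (by fun_prop)).const_mul _

lemma antitoneOn_energyKernel : AntitoneOn energyKernel (Ici 0) := by
  intro r (hr : 0 ≤ r) s _ hrs
  refine mul_le_mul_right (setLIntegral_mono (by fun_prop) fun t (ht : 0 < t) => ?_) _
  gcongr

/-! ### The local central limit theorem -/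

/-- The centred Gaussian density of variance `t / 2`, the limit of `heat t`. -/
def gauss (t x : ℝ) : ℝ := (√(Real.pi * t))⁻¹ * Real.exp (-x ^ 2 / t)

lemma integrable_cos_mul_gaussian {b : ℝ} (hb : 0 < b) (k : ℝ) :
    Integrable fun θ : ℝ => Real.cos (k * θ) * Real.exp (-b * θ ^ 2) := by
  refine (integrable_exp_neg_mul_sq hb).mono' (by fun_prop : Continuous _).aestronglyMeasurable
    (.of_forall fun θ => ?_)
  rw [norm_mul, Real.norm_of_nonneg (Real.exp_pos _).le]
  exact mul_le_of_le_one_left (Real.exp_pos _).le (Real.abs_cos_le_one _)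

lemma integral_cos_mul_gaussian {b : ℝ} (hb : 0 < b) (k : ℝ) :
    ∫ θ : ℝ, Real.cos (k * θ) * Real.exp (-b * θ ^ 2) =
      √(Real.pi / b) * Real.exp (-k ^ 2 / (4 * b)) := by
  have hb' : 0 < (b : ℂ).re := by simpa using hb
  have hint : Integrable fun θ : ℝ =>
      Complex.exp (Complex.I * k * θ) * Complex.exp (-(b : ℂ) * θ ^ 2) := by
    refine (integrable_cexp_quadratic hb' (Complex.I * k) 0).congr (.of_forall fun θ => ?_)
    simp only [add_zero]
    rw [Complex.exp_add, mul_comm]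
  have hre : ∀ θ : ℝ, (Complex.exp (Complex.I * k * θ) * Complex.exp (-(b : ℂ) * θ ^ 2)).re =
      Real.cos (k * θ) * Real.exp (-b * θ ^ 2) := fun θ => by
    rw [show Complex.I * k * θ = ((k * θ : ℝ) : ℂ) * Complex.I by push_cast; ring,
      show -(b : ℂ) * θ ^ 2 = ((-b * θ ^ 2 : ℝ) : ℂ) by push_cast; ring,
      ← Complex.ofReal_exp, Complex.re_mul_ofReal, Complex.exp_ofReal_mul_I_re]
  have hvalue : ((Real.pi : ℂ) / b) ^ (1 / 2 : ℂ) * Complex.exp (-(k : ℂ) ^ 2 / (4 * b)) =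
      ((√(Real.pi / b) * Real.exp (-k ^ 2 / (4 * b)) : ℝ) : ℂ) := by
    rw [Real.sqrt_eq_rpow, Complex.ofReal_mul, Complex.ofReal_cpow (by positivity)]
    push_cast
    rfl
  have hfourier := congrArg Complex.re (fourierIntegral_gaussian hb' (k : ℂ))
  rw [hvalue, Complex.ofReal_re, ← RCLike.re_eq_complex_re, ← integral_re hint] at hfourier
  simpa only [RCLike.re_eq_complex_re, hre] using hfourier

lemma gauss_eq_integral {t : ℝ} (ht : 0 < t) (k : ℝ) :
    gauss t k = (2 * Real.pi)⁻¹ * ∫ θ : ℝ, Real.cos (k * θ) * Real.exp (-(t / 4) * θ ^ 2) := by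
  have hsqrt : √(Real.pi / (t / 4)) = 2 * Real.pi * (√(Real.pi * t))⁻¹ := by
    rw [← Real.sqrt_inv,
      show Real.pi / (t / 4) = (2 * Real.pi) ^ 2 * (Real.pi * t)⁻¹ by field_simp; ring,
      Real.sqrt_mul (by positivity), Real.sqrt_sq (by positivity)]
  rw [integral_cos_mul_gaussian (by positivity), gauss, hsqrt, mul_div_cancel₀ t four_ne_zero]
  field_simp

lemma sq_div_four_sub_le_pow_four (θ : ℝ) : θ ^ 2 / 4 - (1 - Real.cos θ) / 2 ≤ θ ^ 4 := by
  rcases le_total |θ| 1 with hθ | hθ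
  · have hcos := (abs_le.1 (Real.cos_bound hθ)).2
    have hθ₄ : 0 ≤ θ ^ 4 := by positivity
    rw [← abs_pow, abs_of_nonneg hθ₄] at hcos
    linarith
  · have hθ₂ : 1 ≤ θ ^ 2 := (one_le_sq_iff_one_le_abs θ).2 hθ
    nlinarith [Real.cos_le_one θ]

lemma walkChar_le_gaussian {t θ : ℝ} (ht : 0 ≤ t) (hθ : |θ| ≤ Real.pi) :
    walkChar t θ ≤ Real.exp (-(t / 10) * θ ^ 2) := by
  have hpi : (1 : ℝ) / 5 ≤ 2 / Real.pi ^ 2 := by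
    rw [div_le_div_iff₀ (by norm_num) (by positivity)]
    nlinarith [Real.pi_lt_d2, Real.pi_pos]
  have hcos : 1 / 5 * θ ^ 2 ≤ 1 - Real.cos θ := by
    linarith [Real.cos_le_one_sub_mul_cos_sq hθ, mul_le_mul_of_nonneg_right hpi (sq_nonneg θ)]
  exact Real.exp_le_exp.2 (by nlinarith)

lemma gaussian_le_walkChar {t : ℝ} (ht : 0 ≤ t) (θ : ℝ) :
    Real.exp (-(t / 4) * θ ^ 2) ≤ walkChar t θ :=
  Real.exp_le_exp.2 (by nlinarith [Real.one_sub_sq_div_two_le_cos (x := θ)])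

lemma walkChar_sub_gaussian_le {t : ℝ} (ht : 0 ≤ t) (θ : ℝ) :
    walkChar t θ - Real.exp (-(t / 4) * θ ^ 2) ≤ t * θ ^ 4 * walkChar t θ := by
  set y := t * (θ ^ 2 / 4 - (1 - Real.cos θ) / 2) with hy
  have hfactor : Real.exp (-(t / 4) * θ ^ 2) = Real.exp (-y) * walkChar t θ := by
    rw [walkChar, ← Real.exp_add, hy]
    ring_nf
  calc walkChar t θ - Real.exp (-(t / 4) * θ ^ 2) = (1 - Real.exp (-y)) * walkChar t θ := by
        rw [hfactor]
        ring
    _ ≤ t * θ ^ 4 * walkChar t θ := by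
        refine mul_le_mul_of_nonneg_right ?_ (walkChar_pos t θ).le
        calc 1 - Real.exp (-y) ≤ y := by linarith [Real.add_one_le_exp (-y)]
          _ ≤ t * θ ^ 4 := mul_le_mul_of_nonneg_left (sq_div_four_sub_le_pow_four θ) ht

lemma pow_four_mul_gaussian_le {t : ℝ} (ht : 0 < t) (θ : ℝ) :
    t * θ ^ 4 * Real.exp (-(t / 10) * θ ^ 2) ≤ 800 / t * Real.exp (-(t / 20) * θ ^ 2) := by
  set y := t * θ ^ 2 / 20 with hy
  have hy₀ : 0 ≤ y := by positivity
  have hexp : Real.exp (-(t / 10) * θ ^ 2) = Real.exp (-y) * Real.exp (-(t / 20) * θ ^ 2) := by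
    rw [← Real.exp_add, hy]
    ring_nf
  have hquad : t * θ ^ 4 * Real.exp (-y) ≤ 800 / t := by
    rw [Real.exp_neg, ← div_eq_mul_inv, div_le_div_iff₀ (Real.exp_pos _) ht]
    calc t * θ ^ 4 * t = 400 * y ^ 2 := by rw [hy]; ring
      _ ≤ 800 * Real.exp y := by linarith [Real.quadratic_le_exp_of_nonneg hy₀]
  rw [hexp, ← mul_assoc]
  gcongr

lemma abs_indicator_walkChar_sub_gaussian_le {t : ℝ} (ht : 1 ≤ t) (θ : ℝ) :
    |(Ioc (-Real.pi) Real.pi).indicator (walkChar t) θ - Real.exp (-(t / 4) * θ ^ 2)| ≤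
      800 / t * Real.exp (-(t / 20) * θ ^ 2) := by
  have ht₀ : 0 < t := one_pos.trans_le ht
  refine le_trans ?_ (pow_four_mul_gaussian_le ht₀ θ)
  by_cases hθ : θ ∈ Ioc (-Real.pi) Real.pi
  · rw [indicator_of_mem hθ, abs_of_nonneg (sub_nonneg.2 (gaussian_le_walkChar ht₀.le θ))]
    refine (walkChar_sub_gaussian_le ht₀.le θ).trans ?_
    gcongr
    exact walkChar_le_gaussian ht₀.le (abs_le.2 ⟨hθ.1.le, hθ.2⟩)
  · have hθ₂ : 1 ≤ θ ^ 2 := by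
      rw [mem_Ioc, not_and_or, not_lt, not_le] at hθ
      rcases hθ with hθ | hθ <;> nlinarith [Real.pi_gt_three]
    rw [indicator_of_notMem hθ, zero_sub, abs_neg, Real.abs_exp]
    calc Real.exp (-(t / 4) * θ ^ 2) ≤ 1 * Real.exp (-(t / 10) * θ ^ 2) := by
          rw [one_mul]
          exact Real.exp_le_exp.2 (by nlinarith)
      _ ≤ t * θ ^ 4 * Real.exp (-(t / 10) * θ ^ 2) := by
          gcongr
          nlinarith [one_le_pow₀ hθ₂ (n := 2)]

lemma heat_eq_integral_indicator (t : ℝ) (k : ℤ) : heat t k = (2 * Real.pi)⁻¹ *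
    ∫ θ : ℝ, Real.cos (k * θ) * (Ioc (-Real.pi) Real.pi).indicator (walkChar t) θ := by
  rw [heat, intervalIntegral.integral_of_le (by linarith [Real.pi_pos]),
    ← integral_indicator measurableSet_Ioc]
  simp only [indicator_mul_right (Ioc (-Real.pi) Real.pi)]

lemma integrable_cos_mul_indicator_walkChar (t : ℝ) (k : ℤ) : Integrable fun θ : ℝ =>
    Real.cos (k * θ) * (Ioc (-Real.pi) Real.pi).indicator (walkChar t) θ := by
  simp only [← indicator_mul_right (Ioc (-Real.pi) Real.pi) (fun θ : ℝ => Real.cos (k * θ))]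
  exact (integrable_indicator_iff measurableSet_Ioc).2
    (intervalIntegrable_cos_mul_walkChar t k _ _).1

lemma exists_abs_heat_sub_gauss_le : ∃ C, 0 < C ∧ ∀ (t : ℝ) (k : ℤ), 1 ≤ t →
    |heat t k - gauss t k| ≤ C / (t * √t) := by
  refine ⟨(2 * Real.pi)⁻¹ * (800 * √(20 * Real.pi)), by positivity, fun t k ht => ?_⟩
  have ht₀ : 0 < t := one_pos.trans_le ht
  rw [heat_eq_integral_indicator, gauss_eq_integral ht₀, ← mul_sub,
    ← integral_sub (integrable_cos_mul_indicator_walkChar t k)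
      (integrable_cos_mul_gaussian (by positivity) _), abs_mul, abs_of_pos (by positivity),
    mul_div_assoc]
  refine mul_le_mul_of_nonneg_left ?_ (by positivity)
  calc |∫ θ : ℝ, (Real.cos (k * θ) * (Ioc (-Real.pi) Real.pi).indicator (walkChar t) θ -
        Real.cos (k * θ) * Real.exp (-(t / 4) * θ ^ 2))|
      ≤ ∫ θ : ℝ, 800 / t * Real.exp (-(t / 20) * θ ^ 2) := by
        rw [← Real.norm_eq_abs]
        refine norm_integral_le_of_norm_le
          ((integrable_exp_neg_mul_sq (by positivity)).const_mul _) (.of_forall fun θ => ?_)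
        rw [← mul_sub, norm_mul]
        exact (mul_le_of_le_one_left (norm_nonneg _) (Real.abs_cos_le_one _)).trans
          (abs_indicator_walkChar_sub_gaussian_le ht θ)
    _ = 800 / t * √(20 * Real.pi / t) := by
        rw [integral_const_mul, integral_gaussian, div_div_eq_mul_div, mul_comm Real.pi]
    _ = 800 * √(20 * Real.pi) / (t * √t) := by
        rw [Real.sqrt_div' _ ht₀.le]
        field_simp

lemma gauss_nonneg (t x : ℝ) : 0 ≤ gauss t x := by
  unfold gauss
  positivity

lemma gauss_le_inv_sqrt {t : ℝ} (ht : 0 < t) (x : ℝ) : gauss t x ≤ (√t)⁻¹ := by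
  have hexp : Real.exp (-x ^ 2 / t) ≤ 1 := by
    rw [neg_div]
    exact Real.exp_le_one_iff.2 (neg_nonpos.2 (by positivity))
  refine (mul_le_of_le_one_right (by positivity) hexp).trans ?_
  gcongr
  exact le_mul_of_one_le_left ht.le (by linarith [Real.pi_gt_three])

lemma norm_toPlane_sq (x : ℤ × ℤ) : ‖toPlane x‖ ^ 2 = (x.1 : ℝ) ^ 2 + (x.2 : ℝ) ^ 2 := by
  simp [toPlane, EuclideanSpace.norm_sq_eq, Fin.sum_univ_two]

lemma norm_toPlane_zero : ‖toPlane 0‖ = 0 := by simpa using norm_toPlane_sq 0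

lemma one_le_norm_toPlane {x : ℤ × ℤ} (hx : x ≠ 0) : 1 ≤ ‖toPlane x‖ := by
  have hsq : 1 ≤ x.1 ^ 2 + x.2 ^ 2 := by
    contrapose! hx
    have h₁ : x.1 ^ 2 = 0 := by nlinarith [sq_nonneg x.1, sq_nonneg x.2]
    have h₂ : x.2 ^ 2 = 0 := by nlinarith [sq_nonneg x.1, sq_nonneg x.2]
    exact Prod.ext (pow_eq_zero_iff two_ne_zero |>.1 h₁) (pow_eq_zero_iff two_ne_zero |>.1 h₂)
  refine (one_le_sq_iff₀ (norm_nonneg _)).1 ?_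
  rw [norm_toPlane_sq]
  exact_mod_cast hsq

lemma gauss_mul_gauss {t : ℝ} (ht : 0 ≤ t) (x : ℤ × ℤ) :
    gauss t x.1 * gauss t x.2 = planarGauss t ‖toPlane x‖ := by
  have hexponent : -‖toPlane x‖ ^ 2 / t = -(x.1 : ℝ) ^ 2 / t + -(x.2 : ℝ) ^ 2 / t := by
    rw [norm_toPlane_sq]
    ring
  have hsqrt : (√(Real.pi * t))⁻¹ * (√(Real.pi * t))⁻¹ = (Real.pi * t)⁻¹ := by
    rw [← mul_inv, Real.mul_self_sqrt (by positivity)]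
  rw [gauss, gauss, planarGauss, hexponent, Real.exp_add, ← hsqrt]
  ring

lemma exists_abs_heat_mul_heat_sub_le : ∃ C, 0 < C ∧ ∀ (t : ℝ) (x : ℤ × ℤ), 1 ≤ t →
    |heat t x.1 * heat t x.2 - planarGauss t ‖toPlane x‖| ≤ C / t ^ 2 := by
  obtain ⟨C, hC, hheat⟩ := exists_abs_heat_sub_gauss_le
  refine ⟨C * (1 + C) + C, by positivity, fun t x ht => ?_⟩
  have ht₀ : 0 < t := one_pos.trans_le ht
  have hgauss : ∀ k : ℤ, |gauss t k| ≤ (√t)⁻¹ := fun k =>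
    (abs_of_nonneg (gauss_nonneg t k)).trans_le (gauss_le_inv_sqrt ht₀ k)
  have hheat_le : |heat t x.2| ≤ (1 + C) * (√t)⁻¹ := by
    have hC_le : C / (t * √t) ≤ C * (√t)⁻¹ := by
      rw [div_eq_mul_inv, mul_inv]
      gcongr
      exact mul_le_of_le_one_left (by positivity) (inv_le_one_of_one_le₀ ht)
    linarith [abs_sub_abs_le_abs_sub (heat t x.2) (gauss t x.2), hheat t x.2 ht, hgauss x.2]
  rw [← gauss_mul_gauss ht₀.le]
  calc |heat t x.1 * heat t x.2 - gauss t x.1 * gauss t x.2|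
      = |(heat t x.1 - gauss t x.1) * heat t x.2 + gauss t x.1 * (heat t x.2 - gauss t x.2)| := by
        ring_nf
    _ ≤ |heat t x.1 - gauss t x.1| * |heat t x.2| + |gauss t x.1| * |heat t x.2 - gauss t x.2| := by
        rw [← abs_mul, ← abs_mul]
        exact abs_add_le _ _
    _ ≤ C / (t * √t) * ((1 + C) * (√t)⁻¹) + (√t)⁻¹ * (C / (t * √t)) := by
        gcongr
        exacts [hheat t x.1 ht, hgauss x.1, hheat t x.2 ht]
    _ = (C * (1 + C) + C) / (t * (√t * √t)) := by field_simp
    _ = (C * (1 + C) + C) / t ^ 2 := by rw [Real.mul_self_sqrt ht₀.le, sq]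

lemma mul_heat_eq_integral_sin (t : ℝ) (k : ℤ) : k * heat t k = (2 * Real.pi)⁻¹ *
    (t / 2 * ∫ θ in (-Real.pi)..Real.pi, Real.sin (k * θ) * (Real.sin θ * walkChar t θ)) := by
  have hsin : ∀ θ, HasDerivAt (fun θ : ℝ => Real.sin (k * θ)) (Real.cos (k * θ) * k) θ :=
    fun θ => by simpa using ((hasDerivAt_id θ).const_mul (k : ℝ)).sin
  have hchar : ∀ θ, HasDerivAt (walkChar t) (walkChar t θ * (-(t / 2) * Real.sin θ)) θ :=
    fun θ => by
      simpa only [neg_neg] using! (((Real.hasDerivAt_cos θ).const_sub 1).const_mul (-(t / 2))).exp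
  have hparts := intervalIntegral.integral_mul_deriv_eq_deriv_mul
    (fun θ _ => hsin θ) (fun θ _ => hchar θ)
    ((by fun_prop : Continuous fun θ : ℝ => Real.cos (k * θ) * k).intervalIntegrable
      (-Real.pi) Real.pi)
    ((by fun_prop : Continuous fun θ : ℝ =>
      walkChar t θ * (-(t / 2) * Real.sin θ)).intervalIntegrable _ _)
  have hright : ∫ θ in (-Real.pi)..Real.pi, Real.cos (k * θ) * k * walkChar t θ =
      k * ∫ θ in (-Real.pi)..Real.pi, Real.cos (k * θ) * walkChar t θ := by
    rw [← intervalIntegral.integral_const_mul]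
    simp only [mul_assoc, mul_left_comm]
  have hleft : ∫ θ in (-Real.pi)..Real.pi,
        Real.sin (k * θ) * (walkChar t θ * (-(t / 2) * Real.sin θ)) =
      -(t / 2) * ∫ θ in (-Real.pi)..Real.pi, Real.sin (k * θ) * (Real.sin θ * walkChar t θ) := by
    rw [← intervalIntegral.integral_const_mul]
    exact intervalIntegral.integral_congr fun θ _ => by ring
  simp only [hleft, hright, mul_neg, Real.sin_neg, Real.sin_int_mul_pi, neg_zero, zero_mul,
    sub_zero, zero_sub] at hparts
  rw [heat]
  linear_combination (2 * Real.pi)⁻¹ * hparts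

lemma abs_mul_abs_heat_le {t : ℝ} (ht : 0 ≤ t) (k : ℤ) : |(k : ℝ)| * |heat t k| ≤ t / 2 := by
  have hbound : ∀ θ ∈ uIoc (-Real.pi) Real.pi,
      ‖Real.sin (k * θ) * (Real.sin θ * walkChar t θ)‖ ≤ 1 := by
    intro θ _
    rw [norm_mul, norm_mul, Real.norm_of_nonneg (walkChar_pos t θ).le]
    exact mul_le_one₀ (Real.abs_sin_le_one _)
      (mul_nonneg (norm_nonneg _) (walkChar_pos t θ).le)
      (mul_le_one₀ (Real.abs_sin_le_one _) (walkChar_pos t θ).le (walkChar_le_one ht θ))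
  have hintegral := intervalIntegral.norm_integral_le_of_norm_le_const hbound
  rw [one_mul, sub_neg_eq_add, abs_of_pos (by positivity), Real.norm_eq_abs] at hintegral
  rw [← abs_mul, mul_heat_eq_integral_sin, abs_mul, abs_mul,
    abs_of_pos (by positivity : 0 < (2 * Real.pi)⁻¹), abs_of_nonneg (by positivity : 0 ≤ t / 2)]
  calc _ ≤ (2 * Real.pi)⁻¹ * (t / 2 * (Real.pi + Real.pi)) := by gcongr
    _ = t / 2 := by field_simp; ring

lemma abs_heat_mul_heat_le_div {t : ℝ} (ht : 0 ≤ t) {x : ℤ × ℤ} (hx : x ≠ 0) :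
    |heat t x.1 * heat t x.2| ≤ t / ‖toPlane x‖ := by
  have hnorm : ‖toPlane x‖ ≤ |(x.1 : ℝ)| + |(x.2 : ℝ)| := by
    refine le_of_sq_le_sq ?_ (by positivity)
    rw [norm_toPlane_sq, ← sq_abs (x.1 : ℝ), ← sq_abs (x.2 : ℝ)]
    nlinarith [abs_nonneg (x.1 : ℝ), abs_nonneg (x.2 : ℝ)]
  rw [le_div_iff₀ (one_pos.trans_le (one_le_norm_toPlane hx)), abs_mul]
  calc |heat t x.1| * |heat t x.2| * ‖toPlane x‖
      ≤ |heat t x.1| * |heat t x.2| * (|(x.1 : ℝ)| + |(x.2 : ℝ)|) := by gcongr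
    _ = |(x.1 : ℝ)| * |heat t x.1| * |heat t x.2| +
          |(x.2 : ℝ)| * |heat t x.2| * |heat t x.1| := by ring
    _ ≤ t / 2 * 1 + t / 2 * 1 := by
        gcongr
        exacts [abs_mul_abs_heat_le ht _, abs_heat_le_one ht _, abs_mul_abs_heat_le ht _,
          abs_heat_le_one ht _]
    _ = t := by ring

lemma abs_setIntegral_Ioi_le {f : ℝ → ℝ} {T A B : ℝ} (hT : 0 < T) (hf : IntegrableOn f (Ioi 0))
    (hshort : ∀ t ∈ Ioc 0 T, |f t| ≤ A) (hlong : ∀ t ∈ Ioi T, |f t| ≤ B / t ^ 2) :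
    |∫ t in Ioi 0, f t| ≤ A * T + B / T := by
  rw [← Ioc_union_Ioi_eq_Ioi hT.le, setIntegral_union (Ioc_disjoint_Ioi le_rfl) measurableSet_Ioi
    (hf.mono_set Ioc_subset_Ioi_self) (hf.mono_set (Ioi_subset_Ioi hT.le))]
  refine (abs_add_le _ _).trans (add_le_add ?_ ?_)
  · simpa [measureReal_def, hT.le] using
      norm_setIntegral_le_of_norm_le_const (μ := volume) (f := f) measure_Ioc_lt_top hshort
  · have hrpow : ∀ t ∈ Ioi T, |f t| ≤ B * t ^ (-2 : ℝ) := fun t ht => by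
      simpa [Real.rpow_neg (hT.trans ht).le, div_eq_mul_inv] using hlong t ht
    have hint : IntegrableOn (fun t : ℝ => B * t ^ (-2 : ℝ)) (Ioi T) :=
      (integrableOn_Ioi_rpow_of_lt (by norm_num) hT).const_mul _
    calc ‖∫ t in Ioi T, f t‖ ≤ ∫ t in Ioi T, B * t ^ (-2 : ℝ) :=
          norm_integral_le_of_norm_le hint ((ae_restrict_mem measurableSet_Ioi).mono hrpow)
      _ = B / T := by
          rw [integral_const_mul, integral_Ioi_rpow_of_lt (by norm_num : (-2 : ℝ) < -1) hT]
          norm_num [Real.rpow_neg_one, div_eq_mul_inv]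

lemma abs_killedHeat_sub_le (N : ℝ) {t : ℝ} (ht : 0 < t) (x : ℤ × ℤ) (r : ℝ) :
    |killedHeat N t x - Real.exp (-(N ^ 2)⁻¹ * t) * planarGauss t r| ≤
      |heat t x.1 * heat t x.2 - planarGauss t r| := by
  rw [killedHeat, ← mul_sub, abs_mul, Real.abs_exp]
  refine mul_le_of_le_one_left (abs_nonneg _) (Real.exp_le_one_iff.2 ?_)
  rw [neg_mul]
  exact neg_nonpos.2 (by positivity)

lemma abs_heat_mul_heat_sub_le_div {t T : ℝ} (ht : t ∈ Ioc 0 T) (hT : 1 ≤ T) {x : ℤ × ℤ}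
    (hx : x ≠ 0) :
    |heat t x.1 * heat t x.2 - planarGauss t ‖toPlane x‖| ≤ 2 * T / ‖toPlane x‖ := by
  have hx₁ := one_le_norm_toPlane hx
  have hx₀ := one_pos.trans_le hx₁
  have hinv : (‖toPlane x‖ ^ 2)⁻¹ ≤ T / ‖toPlane x‖ := by
    rw [sq, mul_inv, div_eq_mul_inv]
    gcongr
    exact (inv_le_one_of_one_le₀ hx₁).trans hT
  calc |heat t x.1 * heat t x.2 - planarGauss t ‖toPlane x‖|
      ≤ |heat t x.1 * heat t x.2| + |planarGauss t ‖toPlane x‖| := abs_sub _ _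
    _ ≤ T / ‖toPlane x‖ + T / ‖toPlane x‖ := by
        rw [abs_of_pos (planarGauss_pos ht.1 _)]
        gcongr
        · exact (abs_heat_mul_heat_le_div ht.1.le hx).trans (by gcongr; exact ht.2)
        · exact (planarGauss_le_inv_sq hx₀ ht.1).trans hinv
    _ = 2 * T / ‖toPlane x‖ := by ring

/-- Times up to `|x| ^ (1 / 3)` contribute little to either Green function, and the local limit
theorem covers the rest. -/
lemma exists_abs_green_sub_brownianGreen_le : ∃ C, 0 < C ∧ ∀ (N : ℝ) (x : ℤ × ℤ), 0 < N → x ≠ 0 →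
    |green N x - brownianGreen (‖toPlane x‖ / N)| ≤ C * ‖toPlane x‖ ^ (-(1 / 3) : ℝ) := by
  obtain ⟨C, hC, hlimit⟩ := exists_abs_heat_mul_heat_sub_le
  refine ⟨2 + C, by positivity, fun N x hN hx => ?_⟩
  set r := ‖toPlane x‖
  have hr₁ : 1 ≤ r := one_le_norm_toPlane hx
  have hr : 0 < r := one_pos.trans_le hr₁
  set T := r ^ (1 / 3 : ℝ)
  have hT₁ : 1 ≤ T := Real.one_le_rpow hr₁ (by norm_num)
  have hT : 0 < T := one_pos.trans_le hT₁
  have hT₃ : T ^ 3 = r := by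
    rw [← Real.rpow_mul_natCast hr.le]
    norm_num
  have hgauss := integrableOn_exp_mul_planarGauss hr (a := (N ^ 2)⁻¹) (by positivity)
  have hdiff : green N x - brownianGreen (r / N) =
      ∫ t in Ioi 0, (killedHeat N t x - Real.exp (-(N ^ 2)⁻¹ * t) * planarGauss t r) := by
    rw [green, div_eq_inv_mul, brownianGreen_mul (inv_pos.2 hN), inv_pow,
      integral_sub (integrableOn_killedHeat hN x) hgauss]
  rw [hdiff]
  calc _ ≤ 2 * T / r * T + C / T :=
        abs_setIntegral_Ioi_le hT ((integrableOn_killedHeat hN x).sub hgauss)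
          (fun t ht => (abs_killedHeat_sub_le N ht.1 x r).trans
            (abs_heat_mul_heat_sub_le_div ht hT₁ hx))
          fun t ht => (abs_killedHeat_sub_le N (hT.trans ht) x r).trans
            (hlimit t x (hT₁.trans (le_of_lt ht)))
    _ = (2 + C) * r ^ (-(1 / 3) : ℝ) := by
        rw [Real.rpow_neg hr.le, show r ^ (1 / 3 : ℝ) = T from rfl, ← hT₃]
        field_simp

/-! ### Comparison of the two Green functions -/

lemma exists_abs_green_sub_brownianGreen_le_of_far {ε : ℝ} (hε : 0 < ε) : ∃ R, 1 ≤ R ∧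
    ∀ (N : ℝ) (x : ℤ × ℤ), 0 < N → R ≤ ‖toPlane x‖ →
      |green N x - brownianGreen (‖toPlane x‖ / N)| ≤ ε := by
  obtain ⟨C, _, hgreen⟩ := exists_abs_green_sub_brownianGreen_le
  have hdecay : ∀ᶠ r : ℝ in Filter.atTop, C * r ^ (-(1 / 3) : ℝ) < ε := by
    refine Filter.Tendsto.eventually_lt_const hε ?_
    simpa using (tendsto_rpow_neg_atTop (by norm_num : (0 : ℝ) < 1 / 3)).const_mul C
  obtain ⟨R, hR⟩ := Filter.eventually_atTop.1 hdecay
  refine ⟨max 1 R, le_max_left _ _, fun N x hN hx => ?_⟩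
  have hx₀ : x ≠ 0 := by
    rintro rfl
    have := norm_toPlane_zero
    linarith [le_max_left 1 R]
  exact (hgreen N x hN hx₀).trans (hR _ ((le_max_right _ _).trans hx)).le

lemma exists_abs_green_sub_brownianGreen_le_const : ∃ K, 0 < K ∧ ∀ (N : ℝ) (x : ℤ × ℤ), 0 < N →
    x ≠ 0 → |green N x - brownianGreen (‖toPlane x‖ / N)| ≤ K := by
  obtain ⟨C, hC, hgreen⟩ := exists_abs_green_sub_brownianGreen_le
  exact ⟨C, hC, fun N x hN hx => (hgreen N x hN hx).trans (mul_le_of_le_one_right hC.le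
    (Real.rpow_le_one_of_one_le_of_nonpos (one_le_norm_toPlane hx) (by norm_num)))⟩

/-- The relative error is small both near the diagonal, where the Green functions blow up, and far
from it, where the absolute error tends to `0`. -/
lemma exists_abs_green_sub_brownianGreen_le_mul {ε a : ℝ} (hε : 0 < ε) (ha : 0 < a) :
    ∃ C, 0 < C ∧ ∀ (N L : ℝ) (x : ℤ × ℤ), C ≤ N → x ≠ 0 → 0 < L → L ≤ ‖toPlane x‖ → L ≤ a * N →
      |green N x - brownianGreen (‖toPlane x‖ / N)| ≤ ε * brownianGreen (L / N) := by
  obtain ⟨K, _, hnear⟩ := exists_abs_green_sub_brownianGreen_le_const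
  obtain ⟨η, hη, hblowup⟩ := exists_forall_le_brownianGreen (K / ε)
  obtain ⟨R, hR, hfar⟩ := exists_abs_green_sub_brownianGreen_le_of_far
    (mul_pos hε (brownianGreen_pos ha))
  refine ⟨R / η, by positivity, fun N L x hN hx hL hLx hLa => ?_⟩
  have hN₀ : 0 < N := lt_of_lt_of_le (by positivity) hN
  have hLN : 0 < L / N := by positivity
  rcases le_or_gt (L / N) η with hLη | hLη
  · exact (hnear N x hN₀ hx).trans ((div_le_iff₀' hε).1 (hblowup _ hLN hLη))
  · have hRx : R ≤ ‖toPlane x‖ := calc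
      R ≤ η * N := (div_le_iff₀' hη).1 hN
      _ ≤ L := ((lt_div_iff₀ hN₀).1 hLη).le
      _ ≤ ‖toPlane x‖ := hLx
    refine (hfar N x hN₀ hRx).trans ?_
    gcongr
    exact antitoneOn_brownianGreen hLN ha ((div_le_iff₀ hN₀).2 hLa)

lemma exists_green_le {ε a : ℝ} (hε : 0 < ε) (ha : 0 < a) :
    ∃ C, 0 < C ∧ ∀ (N L : ℝ) (x : ℤ × ℤ), C ≤ N → x ≠ 0 → 0 < L → L ≤ ‖toPlane x‖ → L ≤ a * N →
      green N x ≤ (1 + ε) * brownianGreen (L / N) := by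
  obtain ⟨C, hC, hrel⟩ := exists_abs_green_sub_brownianGreen_le_mul hε ha
  refine ⟨C, hC, fun N L x hN hx hL hLx hLa => ?_⟩
  have hN₀ : 0 < N := hC.trans_le hN
  have hanti : brownianGreen (‖toPlane x‖ / N) ≤ brownianGreen (L / N) :=
    antitoneOn_brownianGreen (div_pos hL hN₀) (div_pos (hL.trans_le hLx) hN₀) (by gcongr)
  linarith [(abs_le.1 (hrel N L x hN hx hL hLx hLa)).2]

lemma green_one_zero_le {N : ℝ} (hN : 0 < N) : green N (1, 0) ≤ green N 0 := by
  have hne : ((1, 0) : ℤ × ℤ) ≠ 0 := by decide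
  have hpos := sum_nonneg_of_posSemidef (posSemidef_green hN) {0, (1, 0)}
    fun x => if x = 0 then 1 else -1
  simp only [Finset.sum_pair hne.symm, if_true, if_neg hne, Matrix.of_apply, sub_self, zero_sub,
    sub_zero, green_neg] at hpos
  linarith

lemma exists_le_green {ε a : ℝ} (hε : 0 < ε) (hε₁ : ε ≤ 1) (ha : 0 < a) :
    ∃ C, 0 < C ∧ ∀ (N L : ℝ) (x : ℤ × ℤ), C ≤ N → 1 ≤ L → ‖toPlane x‖ ≤ L → L ≤ a * N →
      (1 - ε) * brownianGreen (L / N) ≤ green N x := by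
  obtain ⟨C, hC, hrel⟩ := exists_abs_green_sub_brownianGreen_le_mul hε ha
  refine ⟨C, hC, fun N L x hN hL hxL hLa => ?_⟩
  have hN₀ : 0 < N := hC.trans_le hN
  wlog hx : x ≠ 0 generalizing x
  · have hnorm : ‖toPlane (1, 0)‖ = 1 := by
      simpa using congrArg Real.sqrt (norm_toPlane_sq (1, 0))
    rw [not_not.1 hx]
    exact (this (1, 0) (hnorm.trans_le hL) (by decide)).trans (green_one_zero_le hN₀)
  have hx₀ : 0 < ‖toPlane x‖ := one_pos.trans_le (one_le_norm_toPlane hx)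
  have hanti : brownianGreen (L / N) ≤ brownianGreen (‖toPlane x‖ / N) :=
    antitoneOn_brownianGreen (div_pos hx₀ hN₀) (div_pos (by linarith) hN₀) (by gcongr)
  calc (1 - ε) * brownianGreen (L / N) ≤ (1 - ε) * brownianGreen (‖toPlane x‖ / N) :=
        mul_le_mul_of_nonneg_left hanti (by linarith)
    _ ≤ green N x := by
        linarith [(abs_le.1 (hrel N _ x hN hx hx₀ le_rfl (hxL.trans hLa))).1]

lemma exists_green_le_of_far_cells {ε δ : ℝ} (hε : 0 < ε) (hδ : δ ∈ Ioo (0 : ℝ) 1) :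
    ∃ C, 0 < C ∧ ∀ (N P m : ℝ) (x : ℤ × ℤ), C ≤ P → P ≤ N → 1 ≤ m → m ≤ P →
      (m - δ) * N / P ≤ ‖toPlane x‖ → green N x ≤ (1 + ε) * brownianGreen ((m + 1) / P) := by
  obtain ⟨hδ₀, hδ₁⟩ := hδ
  set t := min 1 (ε / 3)
  have ht : 0 < t := by positivity
  have htε : (1 + t) * (1 + t) ≤ 1 + ε := by
    nlinarith [min_le_left 1 (ε / 3), min_le_right 1 (ε / 3)]
  have h1δ : 0 < 1 - δ := sub_pos.2 hδ₁
  obtain ⟨C, hC, hgreen⟩ := exists_green_le ht one_pos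
  obtain ⟨η, hη, hslow⟩ := exists_brownianGreen_le_mul ht two_pos
    (by positivity : 0 < 2 / (1 - δ))
  refine ⟨max C (2 / η), lt_max_of_lt_left hC, fun N P m x hP hPN hm hmP hx => ?_⟩
  obtain ⟨hCP, hηP⟩ := max_le_iff.1 hP
  have hP₀ : 0 < P := hC.trans_le hCP
  have hN₀ : 0 < N := hP₀.trans_le hPN
  have hmδ : 0 < m - δ := by linarith
  have hL : 0 < (m - δ) * N / P := by positivity
  have hx₀ : x ≠ 0 := by
    rintro rfl
    have := norm_toPlane_zero
    linarith
  have hratio : (m + 1) / P ≤ 2 / (1 - δ) * ((m - δ) / P) := by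
    rw [← mul_div_assoc]
    gcongr
    rw [div_mul_eq_mul_div, le_div_iff₀ h1δ]
    nlinarith
  have hgap : (m + 1) / P ≤ (m - δ) / P + η := by
    rw [div_le_iff₀ hη] at hηP
    rw [div_le_iff₀ hP₀, add_mul, div_mul_cancel₀ _ hP₀.ne']
    linarith
  calc green N x ≤ (1 + t) * brownianGreen ((m - δ) * N / P / N) :=
        hgreen N _ x (hCP.trans hPN) hx₀ hL hx (by
          rw [one_mul, div_le_iff₀ hP₀, mul_comm]
          gcongr
          linarith)
    _ = (1 + t) * brownianGreen ((m - δ) / P) := by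
        congr 2
        field_simp
    _ ≤ (1 + t) * ((1 + t) * brownianGreen ((m + 1) / P)) := by
        gcongr
        exact hslow _ _ (by positivity) (by gcongr; linarith) hratio hgap
          ((div_le_iff₀ hP₀).2 (by linarith))
    _ ≤ (1 + ε) * brownianGreen ((m + 1) / P) := by
        rw [← mul_assoc]
        exact mul_le_mul_of_nonneg_right htε (brownianGreen_nonneg _)

lemma exists_le_green_of_near_cells {ε c : ℝ} (hε : 0 < ε) (hε₁ : ε ≤ 1) (hc : 1 ≤ c) :
    ∃ C, 0 < C ∧ ∀ (N P m : ℝ) (x : ℤ × ℤ), C ≤ P → P ≤ N → 0 ≤ m → m ≤ P →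
      ‖toPlane x‖ ≤ (m + c) * N / P → (1 - ε) * brownianGreen ((m + c) / P) ≤ green N x := by
  obtain ⟨C, hC, hgreen⟩ := exists_le_green hε hε₁ two_pos
  refine ⟨max C c, lt_max_of_lt_left hC, fun N P m x hP hPN hm hmP hx => ?_⟩
  obtain ⟨hCP, hcP⟩ := max_le_iff.1 hP
  have hP₀ : 0 < P := hC.trans_le hCP
  have hN₀ : 0 < N := hP₀.trans_le hPN
  have hL : 1 ≤ (m + c) * N / P := by
    rw [mul_div_assoc]
    exact one_le_mul_of_one_le_of_one_le (by linarith) ((one_le_div hP₀).2 hPN)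
  have hbound := hgreen N _ x (hCP.trans hPN) hL hx (by
    rw [div_le_iff₀ hP₀, mul_right_comm]
    gcongr
    linarith)
  rwa [show (m + c) * N / P / N = (m + c) / P by field_simp] at hbound

/-! ### Averages of the energy kernel over cells -/

/-- The `i`-th interval of length `1 / M` of the real line, over which the mass of the `i`-th set
is spread. -/
def cell (M i : ℕ) : Set ℝ := Ioc (((i : ℝ) - 1) / M) (i / M)

lemma measurableSet_cell (M i : ℕ) : MeasurableSet (cell M i) := measurableSet_Ioc

lemma mem_cell {M : ℕ} (hM : 0 < M) {i : ℕ} {u : ℝ} :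
    u ∈ cell M i ↔ M * u ∈ Ioc ((i : ℝ) - 1) i := by
  have hM' : (0 : ℝ) < M := Nat.cast_pos.2 hM
  rw [cell, mem_Ioc, mem_Ioc, div_lt_iff₀' hM', le_div_iff₀' hM']

lemma mul_volume_cell {M : ℕ} (hM : 0 < M) (i : ℕ) : (M : ℝ≥0∞) * volume (cell M i) = 1 := by
  have hM' : (0 : ℝ) < M := Nat.cast_pos.2 hM
  have hlength : (i : ℝ) / M - (i - 1) / M = (M : ℝ)⁻¹ := by
    field_simp
    ring
  rw [cell, Real.volume_Ioc, hlength, ENNReal.ofReal_inv_of_pos hM', ENNReal.ofReal_natCast]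
  exact ENNReal.mul_inv_cancel (Nat.cast_ne_zero.2 hM.ne') (ENNReal.natCast_ne_top M)

lemma cell_subset_Ioc {M i : ℕ} (hi : i ∈ Finset.Icc 1 M) : cell M i ⊆ Ioc 0 1 := by
  rw [Finset.mem_Icc] at hi
  have hi₁ : (1 : ℝ) ≤ i := Nat.one_le_cast.2 hi.1
  have hiM : (i : ℝ) ≤ M := Nat.cast_le.2 hi.2
  have hM : (0 : ℝ) < M := by linarith
  exact Ioc_subset_Ioc (div_nonneg (by linarith) hM.le) ((div_le_one hM).2 hiM)

lemma pairwiseDisjoint_cell {M : ℕ} (hM : 0 < M) (s : Set ℕ) : s.PairwiseDisjoint (cell M) := by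
  refine fun i _ j _ hij => Set.disjoint_left.2 fun u hu hv => hij ?_
  obtain ⟨hi, hi'⟩ := (mem_cell hM).1 hu
  obtain ⟨hj, hj'⟩ := (mem_cell hM).1 hv
  have hij : (i : ℝ) < j + 1 := by linarith
  have hji : (j : ℝ) < i + 1 := by linarith
  norm_cast at hij hji
  omega

lemma abs_mul_abs_sub_sub_abs_le_one {M k l s t : ℝ} (hM : 0 ≤ M) (hs : M * s ∈ Icc (k - 1) k)
    (ht : M * t ∈ Icc (l - 1) l) : |(M * |s - t| - |k - l|)| ≤ 1 := calc
  |(M * |s - t| - |k - l|)| = |(|M * s - M * t| - |k - l|)| := by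
    rw [← mul_sub, abs_mul, abs_of_nonneg hM]
  _ ≤ |M * s - M * t - (k - l)| := abs_abs_sub_abs_le _ _
  _ ≤ 1 := abs_le.2 ⟨by linarith [hs.1, ht.2], by linarith [hs.2, ht.1]⟩

lemma abs_mul_abs_sub_sub_abs_le_one_of_mem_cell {M i j : ℕ} (hM : 0 < M) {u v : ℝ}
    (hu : u ∈ cell M i) (hv : v ∈ cell M j) : |(M * |u - v| - |(i : ℝ) - j|)| ≤ 1 :=
  abs_mul_abs_sub_sub_abs_le_one (Nat.cast_nonneg M) (Ioc_subset_Icc_self ((mem_cell hM).1 hu))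
    (Ioc_subset_Icc_self ((mem_cell hM).1 hv))

lemma intervalIntegrable_inv_sqrt_abs :
    IntervalIntegrable (fun s : ℝ => (√|s|)⁻¹) volume (-1) 1 := by
  have hpos : IntervalIntegrable (fun s : ℝ => (√|s|)⁻¹) volume 0 1 := by
    refine (intervalIntegral.intervalIntegrable_rpow' (r := -(1 / 2)) (by norm_num)).congr ?_
    intro s hs
    rw [uIoc_of_le zero_le_one] at hs
    simp only
    rw [abs_of_pos hs.1, Real.sqrt_eq_rpow, Real.rpow_neg hs.1.le]
  have hneg := (IntervalIntegrable.iff_comp_neg (by simp)).1 hpos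
  simp only [abs_neg, neg_zero] at hneg
  exact hneg.symm.trans hpos

lemma lintegral_indicator_inv_sqrt_abs_ne_top :
    ∫⁻ s, (Ioc (-1 : ℝ) 1).indicator (fun s => ENNReal.ofReal (√|s|)⁻¹) s ≠ ⊤ := by
  rw [lintegral_indicator measurableSet_Ioc]
  exact ((intervalIntegrable_iff_integrableOn_Ioc_of_le (by norm_num)).1
    intervalIntegrable_inv_sqrt_abs).lintegral_lt_top.ne

lemma ofReal_inv_sqrt_abs_le (s : ℝ) : ENNReal.ofReal (√|s|)⁻¹ ≤
    1 + (Ioc (-1 : ℝ) 1).indicator (fun s => ENNReal.ofReal (√|s|)⁻¹) s := by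
  by_cases hs : s ∈ Ioc (-1 : ℝ) 1
  · rw [indicator_of_mem hs]
    exact le_add_self
  · refine le_add_of_le_of_nonneg (ENNReal.ofReal_le_one.2 (inv_le_one_of_one_le₀ ?_)) zero_le
    rw [Real.one_le_sqrt]
    rw [mem_Ioc, not_and_or, not_lt, not_le] at hs
    rcases hs with hs | hs
    · linarith [neg_abs_le s]
    · linarith [le_abs_self s]

lemma mul_lintegral_comp_mul_sub {φ : ℝ → ℝ≥0∞} (hφ : Measurable φ) {M : ℝ} (hM : 0 < M) (u : ℝ) :
    ENNReal.ofReal M * ∫⁻ v, φ (M * (u - v)) = ∫⁻ s, φ s := by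
  rw [lintegral_sub_left_eq_self (fun v => φ (M * v)) u,
    ← lintegral_map (f := φ) (g := fun v : ℝ => M * v) hφ (by fun_prop),
    Real.map_volume_mul_left hM.ne', lintegral_smul_measure, abs_of_pos (by positivity),
    smul_eq_mul, ← mul_assoc, ← ENNReal.ofReal_mul hM.le, mul_inv_cancel₀ hM.ne',
    ENNReal.ofReal_one, one_mul]

lemma exists_average_inv_sqrt_le : ∃ I : ℝ, 0 ≤ I ∧ ∀ (M i : ℕ) (u : ℝ), 0 < M →
    (M : ℝ≥0∞) * ∫⁻ v in cell M i, ENNReal.ofReal (√(M * |u - v|))⁻¹ ≤ ENNReal.ofReal I := by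
  set φ : ℝ → ℝ≥0∞ := (Ioc (-1 : ℝ) 1).indicator fun s => ENNReal.ofReal (√|s|)⁻¹
  have hφm : Measurable φ := Measurable.indicator (by fun_prop) measurableSet_Ioc
  refine ⟨1 + (∫⁻ s, φ s).toReal, by positivity, fun M i u hM => ?_⟩
  calc (M : ℝ≥0∞) * ∫⁻ v in cell M i, ENNReal.ofReal (√(M * |u - v|))⁻¹
      ≤ M * ∫⁻ v in cell M i, (1 + φ (M * (u - v))) := by
        gcongr with v
        simpa only [abs_mul, Nat.abs_cast] using ofReal_inv_sqrt_abs_le (M * (u - v))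
    _ = M * volume (cell M i) + M * ∫⁻ v in cell M i, φ (M * (u - v)) := by
        rw [lintegral_add_left measurable_const, lintegral_const, one_mul,
          Measure.restrict_apply_univ, mul_add]
    _ ≤ M * volume (cell M i) + M * ∫⁻ v, φ (M * (u - v)) := by
        gcongr
        exact Measure.restrict_le_self
    _ = ENNReal.ofReal (1 + (∫⁻ s, φ s).toReal) := by
        rw [mul_volume_cell hM, ← ENNReal.ofReal_natCast,
          mul_lintegral_comp_mul_sub hφm (Nat.cast_pos.2 hM), ENNReal.ofReal_add zero_le_one
          ENNReal.toReal_nonneg, ENNReal.ofReal_one,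
          ENNReal.ofReal_toReal lintegral_indicator_inv_sqrt_abs_ne_top]

lemma brownianGreen_le_add_sqrt {r s : ℝ} (hr : 0 < r) (hrs : r ≤ s) :
    brownianGreen r ≤ brownianGreen s + Real.Gamma (1 / 4) * √(s / r) := by
  have hratio : 1 ≤ s / r := (one_le_div hr).2 hrs
  have hdiff := brownianGreen_sub_le hr hratio (p := 1 / 4) (by norm_num) (by norm_num)
  rw [div_mul_cancel₀ s hr.ne'] at hdiff
  have hroot : ((s / r) ^ 2 - 1) ^ (1 / 4 : ℝ) ≤ √(s / r) := calc
    ((s / r) ^ 2 - 1) ^ (1 / 4 : ℝ) ≤ ((s / r) ^ 2) ^ (1 / 4 : ℝ) := by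
      gcongr
      · linarith [one_le_pow₀ hratio (n := 2)]
      · linarith
    _ = √(s / r) := by
      rw [Real.sqrt_eq_rpow, ← Real.rpow_natCast, ← Real.rpow_mul (by positivity)]
      norm_num
  have hΓ : 0 < Real.Gamma (1 / 4) := Real.Gamma_pos_of_pos (by norm_num)
  nlinarith

lemma average_le_of_forall_le {M : ℕ} (hM : 0 < M) (j : ℕ) {f : ℝ → ℝ≥0∞} {B : ℝ≥0∞}
    (hf : ∀ v ∈ cell M j, f v ≤ B) : M * ∫⁻ v in cell M j, f v ≤ B := calc
  M * ∫⁻ v in cell M j, f v ≤ M * ∫⁻ _ in cell M j, B :=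
    mul_le_mul_right (setLIntegral_mono' (measurableSet_cell M j) hf) _
  _ = B := by
    rw [lintegral_const, Measure.restrict_apply_univ, mul_left_comm, mul_volume_cell hM, mul_one]

lemma energyKernel_le_add_inv_sqrt {M k a r : ℝ} (hM : 0 < M) (hr : 0 < r) (hrk : M * r ≤ k)
    (hka : k ≤ a) : energyKernel r ≤ ENNReal.ofReal (brownianGreen (k / M)) +
      ENNReal.ofReal (Real.Gamma (1 / 4) * √a) * ENNReal.ofReal (√(M * r))⁻¹ := by
  have hratio : k / M / r ≤ a * (M * r)⁻¹ := by
    rw [div_div, div_eq_mul_inv]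
    gcongr
  have ha : 0 ≤ a := (by positivity : 0 ≤ M * r).trans (hrk.trans hka)
  rw [energyKernel_eq hr, ← ENNReal.ofReal_mul (by positivity),
    ← ENNReal.ofReal_add (brownianGreen_nonneg _) (by positivity)]
  refine ENNReal.ofReal_le_ofReal ((brownianGreen_le_add_sqrt hr
    ((le_div_iff₀' hM).2 hrk)).trans (add_le_add_right ?_ _))
  rw [mul_assoc, ← Real.sqrt_inv, ← Real.sqrt_mul ha]
  gcongr

lemma exists_average_energyKernel_le_add {c : ℝ} (hc : 1 ≤ c) :
    ∃ B : ℝ, ∀ (M i j : ℕ) (u : ℝ), 0 < M → |(i : ℝ) - j| ≤ 1 → u ∈ cell M i →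
      (M : ℝ≥0∞) * ∫⁻ v in cell M j, energyKernel |u - v| ≤
        ENNReal.ofReal (brownianGreen ((|(i : ℝ) - j| + c) / M) + B) := by
  obtain ⟨I, hI, haverage⟩ := exists_average_inv_sqrt_le
  set D := Real.Gamma (1 / 4) * √(1 + c)
  refine ⟨D * I, fun M i j u hM hij hu => ?_⟩
  have hM' : (0 : ℝ) < M := Nat.cast_pos.2 hM
  set m := |(i : ℝ) - j|
  have hpointwise : ∀ v ∈ cell M j, v ≠ u → energyKernel |u - v| ≤
      ENNReal.ofReal (brownianGreen ((m + c) / M)) +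
        ENNReal.ofReal D * ENNReal.ofReal (√(M * |u - v|))⁻¹ := fun v hv hvu =>
    energyKernel_le_add_inv_sqrt hM' (abs_pos.2 (sub_ne_zero.2 hvu.symm)) (by
      linarith [(abs_le.1 (abs_mul_abs_sub_sub_abs_le_one_of_mem_cell hM hu hv)).2]) (by linarith)
  calc (M : ℝ≥0∞) * ∫⁻ v in cell M j, energyKernel |u - v|
      ≤ M * ∫⁻ v in cell M j, (ENNReal.ofReal (brownianGreen ((m + c) / M)) +
        ENNReal.ofReal D * ENNReal.ofReal (√(M * |u - v|))⁻¹) := by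
        refine mul_le_mul_right (lintegral_mono_ae ?_) _
        filter_upwards [ae_restrict_mem (measurableSet_cell M j),
          ae_restrict_of_ae (Measure.ae_ne volume u)] with v hv hvu using hpointwise v hv hvu
    _ = ENNReal.ofReal (brownianGreen ((m + c) / M)) * (M * volume (cell M j)) +
        ENNReal.ofReal D * (M * ∫⁻ v in cell M j, ENNReal.ofReal (√(M * |u - v|))⁻¹) := by
        rw [lintegral_add_left measurable_const, lintegral_const_mul _ (by fun_prop),
          lintegral_const, Measure.restrict_apply_univ]
        ring
    _ ≤ ENNReal.ofReal (brownianGreen ((m + c) / M)) * 1 +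
        ENNReal.ofReal D * ENNReal.ofReal I := by
        rw [mul_volume_cell hM]
        gcongr
        exact haverage M j u hM
    _ = ENNReal.ofReal (brownianGreen ((m + c) / M) + D * I) := by
        rw [mul_one, ← ENNReal.ofReal_mul (by positivity),
          ← ENNReal.ofReal_add (brownianGreen_nonneg _) (by positivity)]

lemma abs_natCast_sub_le_one_or_two_le (i j : ℕ) : |(i : ℝ) - j| ≤ 1 ∨ 2 ≤ |(i : ℝ) - j| := by
  have hcast : |(i : ℝ) - j| = ((|(i : ℤ) - j| : ℤ) : ℝ) := by push_cast; rfl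
  rw [hcast]
  norm_cast
  omega

lemma exists_average_energyKernel_le {ε c : ℝ} (hε : 0 < ε) (hc : 1 ≤ c) : ∃ M₀ : ℝ, 0 < M₀ ∧
    ∀ (M i j : ℕ) (u : ℝ), M₀ ≤ M → |(i : ℝ) - j| ≤ M → u ∈ cell M i →
      (M : ℝ≥0∞) * ∫⁻ v in cell M j, energyKernel |u - v| ≤
        ENNReal.ofReal ((1 + ε) * brownianGreen ((|(i : ℝ) - j| + c) / M)) := by
  obtain ⟨B, hnear⟩ := exists_average_energyKernel_le_add hc
  obtain ⟨ζ, hζ, hblowup⟩ := exists_forall_le_brownianGreen (B / ε)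
  obtain ⟨η, hη, hfar⟩ := exists_brownianGreen_le_mul hε (a := 1 + c) (b := 2 + c)
    (by positivity) (by positivity)
  refine ⟨max 1 (max ((1 + c) / ζ) ((1 + c) / η)), by positivity, fun M i j u hM hij hu => ?_⟩
  simp only [max_le_iff, div_le_iff₀ hζ, div_le_iff₀ hη] at hM
  obtain ⟨hM₁, hMζ, hMη⟩ := hM
  have hM' : (0 : ℝ) < M := by linarith
  have hM₀ : 0 < M := Nat.cast_pos.1 hM'
  rcases abs_natCast_sub_le_one_or_two_le i j with hone | htwo
  · refine (hnear M i j u hM₀ hone hu).trans (ENNReal.ofReal_le_ofReal ?_)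
    have hB' : B / ε ≤ brownianGreen ((|(i : ℝ) - j| + c) / M) :=
      hblowup _ (by positivity) ((div_le_iff₀ hM').2 (by linarith))
    rw [div_le_iff₀ hε] at hB'
    linarith
  · refine average_le_of_forall_le hM₀ j fun v hv => ?_
    have hdist : (|(i : ℝ) - j| - 1) / M ≤ |u - v| := (div_le_iff₀' hM').2 (by
      linarith [(abs_le.1 (abs_mul_abs_sub_sub_abs_le_one_of_mem_cell hM₀ hu hv)).1])
    have hgap : 0 < (|(i : ℝ) - j| - 1) / M := div_pos (by linarith) hM'
    refine (antitoneOn_energyKernel hgap.le (mem_Ici.2 (abs_nonneg _)) hdist).trans ?_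
    rw [energyKernel_eq hgap]
    refine ENNReal.ofReal_le_ofReal (hfar _ _ hgap (by gcongr; linarith) ?_ ?_ ?_)
    · rw [mul_div_assoc']
      gcongr
      nlinarith
    · rw [div_add' _ _ _ hM'.ne']
      exact div_le_div_of_nonneg_right (by linarith) hM'.le
    · rw [div_le_iff₀ hM']
      nlinarith

/-! ### Energies of measures on the segment -/

/-- The least energy of a probability measure on the unit segment, the inverse of
`capBrownian unitSegment`. -/
def minEnergy : ℝ≥0∞ :=
  ⨅ (μ : Measure Plane) (_ : IsProbabilityMeasure μ) (_ : μ unitSegmentᶜ = 0), energy μ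

lemma capBrownian_unitSegment : capBrownian unitSegment = minEnergy⁻¹ := rfl

lemma minEnergy_le {μ : Measure Plane} [IsProbabilityMeasure μ] (hμ : μ unitSegmentᶜ = 0) :
    minEnergy ≤ energy μ :=
  iInf_le_of_le μ (iInf_le_of_le inferInstance (iInf_le_of_le hμ le_rfl))

lemma measurableSet_unitSegment : MeasurableSet unitSegment :=
  (measurableSet_Icc.preimage (by fun_prop : Measurable fun z : Plane => z 0)).inter
    ((measurableSet_singleton (0 : ℝ)).preimage (by fun_prop : Measurable fun z : Plane => z 1))

lemma dist_of_mem_unitSegment {x y : Plane} (hx : x ∈ unitSegment) (hy : y ∈ unitSegment) :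
    dist x y = |x 0 - y 0| := by
  simp [EuclideanSpace.dist_eq, Fin.sum_univ_two, hx.2, hy.2, Real.dist_eq, Real.sqrt_sq_eq_abs]

lemma energy_eq (μ : Measure Plane) : energy μ = ∫⁻ x, ∫⁻ y, energyKernel (dist x y) ∂μ ∂μ := rfl

lemma energy_smul {c : ℝ≥0∞} (hc : c ≠ ⊤) (μ : Measure Plane) :
    energy (c • μ) = c * c * energy μ := by
  simp only [energy_eq, lintegral_smul_measure, smul_eq_mul]
  rw [lintegral_const_mul' _ _ hc, mul_assoc]

lemma minEnergy_pos : 0 < minEnergy := by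
  have hkernel : 0 < energyKernel 1 := by
    rw [energyKernel_eq one_pos, ENNReal.ofReal_pos]
    exact brownianGreen_pos one_pos
  refine hkernel.trans_le (le_iInf fun μ => le_iInf fun _ => le_iInf fun hμ => ?_)
  have hsupport : ∀ᵐ z ∂μ, z ∈ unitSegment := hμ
  calc energyKernel 1 = ∫⁻ _, ∫⁻ _, energyKernel 1 ∂μ ∂μ := by simp
    _ ≤ energy μ := by
      rw [energy_eq]
      refine lintegral_mono_ae ?_
      filter_upwards [hsupport] with x hx
      refine lintegral_mono_ae ?_
      filter_upwards [hsupport] with y hy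
      refine antitoneOn_energyKernel (mem_Ici.2 dist_nonneg) (mem_Ici.2 zero_le_one) ?_
      rw [dist_of_mem_unitSegment hx hy, abs_le]
      constructor <;> linarith [hx.1.1, hx.1.2, hy.1.1, hy.1.2]

/-- The energy of a measure on the line, for the same kernel as in the plane. -/
def lineEnergy (ρ : Measure ℝ) : ℝ≥0∞ := ∫⁻ u, ∫⁻ v, energyKernel |u - v| ∂ρ ∂ρ

/-- The embedding of the line as the first coordinate axis. -/
def axis (u : ℝ) : Plane := !₂[u, 0]

lemma measurable_axis : Measurable axis := by
  have hcontinuous : Continuous axis := by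
    unfold axis
    fun_prop
  exact hcontinuous.measurable

lemma dist_axis (u v : ℝ) : dist (axis u) (axis v) = |u - v| := by
  simp [axis, EuclideanSpace.dist_eq, Real.dist_eq, Real.sqrt_sq_eq_abs]

lemma energy_map_axis (ρ : Measure ℝ) [SFinite ρ] : energy (ρ.map axis) = lineEnergy ρ := by
  have hkernel : Measurable fun p : Plane × Plane => energyKernel (dist p.1 p.2) :=
    measurable_energyKernel.comp (by fun_prop)
  rw [energy_eq, lineEnergy,
    lintegral_map (Measurable.lintegral_prod_right' hkernel) measurable_axis]
  refine lintegral_congr fun u => ?_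
  refine (lintegral_map (hkernel.comp (by fun_prop : Measurable fun y : Plane => (axis u, y)))
    measurable_axis).trans ?_
  simp only [Function.comp_apply, dist_axis]

lemma map_axis_compl_unitSegment {ρ : Measure ℝ} (hρ : ρ (Icc 0 1)ᶜ = 0) :
    ρ.map axis unitSegmentᶜ = 0 := by
  rw [Measure.map_apply measurable_axis measurableSet_unitSegment.compl]
  have hsubset : axis ⁻¹' unitSegmentᶜ ⊆ (Icc (0 : ℝ) 1)ᶜ :=
    fun u hu hmem => hu (by simpa [axis, unitSegment] using hmem)
  exact measure_mono_null hsubset hρ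

lemma minEnergy_mul_sq_le (ρ : Measure ℝ) [IsFiniteMeasure ρ] (hρ : ρ (Icc 0 1)ᶜ = 0) :
    minEnergy * ρ univ ^ 2 ≤ lineEnergy ρ := by
  rcases eq_or_ne (ρ univ) 0 with hzero | hzero
  · simp [hzero]
  have hcancel : (ρ univ)⁻¹ * ρ univ = 1 := ENNReal.inv_mul_cancel hzero (measure_ne_top _ _)
  have hprob : IsProbabilityMeasure ((ρ univ)⁻¹ • ρ.map axis) := ⟨by
    rw [Measure.smul_apply, Measure.map_apply measurable_axis MeasurableSet.univ, preimage_univ,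
      smul_eq_mul, hcancel]⟩
  have hmin := minEnergy_le (μ := (ρ univ)⁻¹ • ρ.map axis) (by
    rw [Measure.smul_apply, map_axis_compl_unitSegment hρ, smul_zero])
  rw [energy_smul (ENNReal.inv_ne_top.2 hzero), energy_map_axis] at hmin
  calc minEnergy * ρ univ ^ 2
      ≤ (ρ univ)⁻¹ * (ρ univ)⁻¹ * lineEnergy ρ * ρ univ ^ 2 := by gcongr
    _ = ((ρ univ)⁻¹ * ρ univ) ^ 2 * lineEnergy ρ := by ring
    _ = lineEnergy ρ := by rw [hcancel, one_pow, one_mul]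

lemma sum_mul_le_lintegral_lintegral {X ι : Type*} [MeasurableSpace X] (μ : Measure X)
    (s : Finset ι) {B : ι → Set X} (hB : ∀ i, MeasurableSet (B i))
    (hd : (s : Set ι).PairwiseDisjoint B) (F : X → X → ℝ≥0∞) (b : ι → ι → ℝ≥0∞)
    (hb : ∀ i ∈ s, ∀ j ∈ s, ∀ x ∈ B i, ∀ y ∈ B j, b i j ≤ F x y) :
    ∑ i ∈ s, ∑ j ∈ s, μ (B i) * μ (B j) * b i j ≤ ∫⁻ x, ∫⁻ y, F x y ∂μ ∂μ := by
  have hsum : ∀ f : X → ℝ≥0∞, ∑ i ∈ s, ∫⁻ x in B i, f x ∂μ ≤ ∫⁻ x, f x ∂μ := by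
    intro f
    rw [← lintegral_biUnion_finset hd fun i _ => hB i]
    exact setLIntegral_le_lintegral _ _
  have hinner : ∀ i ∈ s, ∀ x ∈ B i, ∑ j ∈ s, μ (B j) * b i j ≤ ∫⁻ y, F x y ∂μ := by
    refine fun i hi x hx => (Finset.sum_le_sum fun j hj => ?_).trans (hsum _)
    rw [mul_comm, ← setLIntegral_const]
    exact setLIntegral_mono' (hB j) fun y hy => hb i hi j hj x hx y hy
  refine (Finset.sum_le_sum fun i hi => ?_).trans (hsum _)
  calc ∑ j ∈ s, μ (B i) * μ (B j) * b i j = (∑ j ∈ s, μ (B j) * b i j) * μ (B i) := by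
        rw [Finset.sum_mul]
        exact Finset.sum_congr rfl fun j _ => by ring
    _ = ∫⁻ _ in B i, ∑ j ∈ s, μ (B j) * b i j ∂μ := (setLIntegral_const _ _).symm
    _ ≤ _ := setLIntegral_mono' (hB i) (hinner i hi)

/-! ### A nearly optimal measure with bounded density -/

/-- The measure that spreads the mass `w i` uniformly over the `i`-th cell, for `i ∈ A`. -/
def smear (M : ℕ) (A : Finset ℕ) (w : ℕ → ℝ≥0∞) : Measure ℝ :=
  ∑ i ∈ A, (w i * M) • volume.restrict (cell M i)

lemma lintegral_smear (M : ℕ) (A : Finset ℕ) (w : ℕ → ℝ≥0∞) (f : ℝ → ℝ≥0∞) :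
    ∫⁻ u, f u ∂smear M A w = ∑ i ∈ A, w i * (M * ∫⁻ u in cell M i, f u) := by
  rw [smear, lintegral_finsetSum_measure]
  simp only [lintegral_smul_measure, smul_eq_mul, mul_assoc]

lemma smear_apply (M : ℕ) (A : Finset ℕ) (w : ℕ → ℝ≥0∞) {S : Set ℝ} (hS : MeasurableSet S) :
    smear M A w S = ∑ i ∈ A, w i * (M * volume (S ∩ cell M i)) := by
  simp [smear, Measure.restrict_apply hS, mul_assoc]

lemma smear_apply_of_subset {M : ℕ} (hM : 0 < M) (A : Finset ℕ) (w : ℕ → ℝ≥0∞) {S : Set ℝ}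
    (hS : MeasurableSet S) (hA : ∀ i ∈ A, cell M i ⊆ S) : smear M A w S = ∑ i ∈ A, w i := by
  rw [smear_apply M A w hS]
  refine Finset.sum_congr rfl fun i hi => ?_
  rw [inter_eq_self_of_subset_right (hA i hi), mul_volume_cell hM, mul_one]

lemma smear_apply_le (M : ℕ) (A : Finset ℕ) (w : ℕ → ℝ≥0∞) {S : Set ℝ} (hS : MeasurableSet S) :
    smear M A w S ≤ (∑ i ∈ A, w i) * (M * volume S) := by
  rw [smear_apply M A w hS, Finset.sum_mul]
  gcongr
  exact inter_subset_left

lemma lineEnergy_smear_le {M : ℕ} (hM : 0 < M) (A : Finset ℕ) (w : ℕ → ℝ≥0∞)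
    (b : ℕ → ℕ → ℝ≥0∞) (hb : ∀ i ∈ A, ∀ j ∈ A, ∀ u ∈ cell M i,
      (M : ℝ≥0∞) * ∫⁻ v in cell M j, energyKernel |u - v| ≤ b i j) :
    lineEnergy (smear M A w) ≤ ∑ i ∈ A, ∑ j ∈ A, w i * w j * b i j := by
  rw [lineEnergy, lintegral_smear]
  refine Finset.sum_le_sum fun i hi => ?_
  calc w i * (M * ∫⁻ u in cell M i, ∫⁻ v, energyKernel |u - v| ∂smear M A w)
      ≤ w i * ∑ j ∈ A, w j * b i j := by
        refine mul_le_mul_right (average_le_of_forall_le hM i fun u hu => ?_) _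
        rw [lintegral_smear]
        gcongr with j hj
        exact hb i hi j hj u hu
    _ = ∑ j ∈ A, w i * w j * b i j := by simp only [Finset.mul_sum, mul_assoc]

lemma abs_natCast_sub_le {M i j : ℕ} (hi : i ∈ Finset.Icc 1 M) (hj : j ∈ Finset.Icc 1 M) :
    |(i : ℝ) - j| ≤ M := by
  have hi' : (i : ℝ) ≤ M := Nat.cast_le.2 (Finset.mem_Icc.1 hi).2
  have hj' : (j : ℝ) ≤ M := Nat.cast_le.2 (Finset.mem_Icc.1 hj).2
  exact abs_sub_le_of_nonneg_of_le (Nat.cast_nonneg _) hi' (Nat.cast_nonneg _) hj'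

/-- The part of the unit segment over the closure of the `k`-th cell, except that the endpoints
shared by two cells go to the left one. -/
def segmentCell (M k : ℕ) : Set Plane := {z | z ∈ unitSegment ∧ max 1 ⌈(M : ℝ) * z 0⌉₊ = k}

lemma measurableSet_segmentCell (M k : ℕ) : MeasurableSet (segmentCell M k) := by
  have hindex : Measurable fun z : Plane => max 1 ⌈(M : ℝ) * z 0⌉₊ :=
    measurable_const.max (Nat.measurable_ceil.comp (by fun_prop))
  exact measurableSet_unitSegment.inter (hindex (measurableSet_singleton k))

lemma pairwiseDisjoint_segmentCell (M : ℕ) (s : Set ℕ) : s.PairwiseDisjoint (segmentCell M) :=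
  fun _ _ _ _ hij => Set.disjoint_left.2 fun _ hi hj => hij (hi.2.symm.trans hj.2)

lemma mul_mem_Icc_of_mem_segmentCell {M k : ℕ} {z : Plane} (hz : z ∈ segmentCell M k) :
    M * z 0 ∈ Icc ((k : ℝ) - 1) k := by
  obtain ⟨⟨⟨hz₀, -⟩, -⟩, rfl⟩ := hz
  have hnonneg : 0 ≤ M * z 0 := mul_nonneg (Nat.cast_nonneg _) hz₀
  rw [Nat.cast_max, Nat.cast_one]
  refine ⟨?_, (Nat.le_ceil _).trans (le_max_right _ _)⟩
  rw [sub_le_iff_le_add]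
  exact max_le (by linarith) (Nat.ceil_lt_add_one hnonneg).le

lemma mul_dist_le_of_mem_segmentCell {M k l : ℕ} {x y : Plane} (hx : x ∈ segmentCell M k)
    (hy : y ∈ segmentCell M l) : M * dist x y ≤ |(k : ℝ) - l| + 1 := by
  rw [dist_of_mem_unitSegment hx.1 hy.1]
  linarith [(abs_le.1 (abs_mul_abs_sub_sub_abs_le_one (Nat.cast_nonneg M)
    (mul_mem_Icc_of_mem_segmentCell hx) (mul_mem_Icc_of_mem_segmentCell hy))).2]

lemma iUnion_segmentCell {M : ℕ} (hM : 0 < M) :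
    ⋃ k ∈ Finset.Icc 1 M, segmentCell M k = unitSegment := by
  refine Subset.antisymm (iUnion₂_subset fun k _ z hz => hz.1) fun z hz => ?_
  refine mem_iUnion₂.2 ⟨max 1 ⌈(M : ℝ) * z 0⌉₊, Finset.mem_Icc.2 ⟨le_max_left _ _, max_le hM ?_⟩,
    hz, rfl⟩
  exact Nat.ceil_le.2 (mul_le_of_le_one_right (Nat.cast_nonneg _) hz.1.2)

lemma sum_measure_segmentCell {M : ℕ} (hM : 0 < M) (μ : Measure Plane) [IsProbabilityMeasure μ]
    (hμ : μ unitSegmentᶜ = 0) : ∑ k ∈ Finset.Icc 1 M, μ (segmentCell M k) = 1 := by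
  rw [← measure_biUnion_finset (pairwiseDisjoint_segmentCell M _)
    fun k _ => measurableSet_segmentCell M k, iUnion_segmentCell hM]
  exact (prob_compl_eq_zero_iff measurableSet_unitSegment).1 hμ

lemma exists_lineEnergy_smear_le {ε : ℝ} (hε : 0 < ε) : ∃ M : ℕ, 0 < M ∧ ∀ μ : Measure Plane,
    lineEnergy (smear M (Finset.Icc 1 M) fun k => μ (segmentCell M k)) ≤
      ENNReal.ofReal (1 + ε) * energy μ := by
  obtain ⟨M₀, hM₀, haverage⟩ := exists_average_energyKernel_le hε le_rfl
  obtain ⟨M, hM⟩ := exists_nat_ge M₀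
  have hM' : (0 : ℝ) < M := hM₀.trans_le hM
  have hMpos : 0 < M := Nat.cast_pos.1 hM'
  refine ⟨M, hMpos, fun μ => ?_⟩
  set b : ℕ → ℕ → ℝ≥0∞ := fun i j => energyKernel ((|(i : ℝ) - j| + 1) / M) with hb
  have hdist : ∀ i j : ℕ, 0 < (|(i : ℝ) - j| + 1) / M := fun i j => by positivity
  have hcells : ∑ i ∈ Finset.Icc 1 M, ∑ j ∈ Finset.Icc 1 M,
      μ (segmentCell M i) * μ (segmentCell M j) * b i j ≤ energy μ :=
    sum_mul_le_lintegral_lintegral μ _ (measurableSet_segmentCell M)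
      (pairwiseDisjoint_segmentCell M _) _ _ fun i _ j _ x hx y hy =>
      antitoneOn_energyKernel (mem_Ici.2 dist_nonneg) (mem_Ici.2 (hdist i j).le)
        ((le_div_iff₀' hM').2 (mul_dist_le_of_mem_segmentCell hx hy))
  refine (lineEnergy_smear_le hMpos _ _ (fun i j => ENNReal.ofReal (1 + ε) * b i j)
    fun i hi j hj u hu => ?_).trans ?_
  · simp only [hb]
    rw [energyKernel_eq (hdist i j), ← ENNReal.ofReal_mul (by positivity)]
    exact haverage M i j u hM (abs_natCast_sub_le hi hj) hu
  · simp only [mul_left_comm _ (ENNReal.ofReal (1 + ε)), ← Finset.mul_sum]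
    gcongr

lemma exists_energy_lt {r : ℝ≥0∞} (hr : minEnergy < r) : ∃ μ : Measure Plane,
    IsProbabilityMeasure μ ∧ μ unitSegmentᶜ = 0 ∧ energy μ < r := by
  simpa only [minEnergy, iInf_lt_iff, exists_prop] using hr

lemma minEnergy_lt_mul {ε : ℝ} (hε : 0 < ε) (hfinite : minEnergy ≠ ⊤) :
    minEnergy < ENNReal.ofReal (1 + ε) * minEnergy := by
  conv_lhs => rw [← one_mul minEnergy]
  refine ENNReal.mul_lt_mul_left minEnergy_pos.ne' hfinite ?_
  rw [← ENNReal.ofReal_one]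
  exact (ENNReal.ofReal_lt_ofReal_iff (by linarith)).2 (by linarith)

lemma exists_lineEnergy_le_of_bounded_density {ε : ℝ} (hε : 0 < ε) (hfinite : minEnergy ≠ ⊤) :
    ∃ (M : ℕ) (ρ : Measure ℝ), 0 < M ∧ IsProbabilityMeasure ρ ∧ ρ (Ioc 0 1) = 1 ∧
      (∀ S, MeasurableSet S → ρ S ≤ M * volume S) ∧
      lineEnergy ρ ≤ ENNReal.ofReal ((1 + ε) ^ 2) * minEnergy := by
  obtain ⟨M, hM, hsmear⟩ := exists_lineEnergy_smear_le hε
  obtain ⟨μ, _, hsupport, hμ⟩ := exists_energy_lt (minEnergy_lt_mul hε hfinite)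
  have hmass := sum_measure_segmentCell hM μ hsupport
  refine ⟨M, smear M (Finset.Icc 1 M) fun k => μ (segmentCell M k), hM, ⟨?_⟩, ?_,
    fun S hS => ?_, ?_⟩
  · rw [smear_apply_of_subset hM _ _ MeasurableSet.univ fun i _ => subset_univ _, hmass]
  · rw [smear_apply_of_subset hM _ _ measurableSet_Ioc fun i hi => cell_subset_Ioc hi, hmass]
  · simpa [hmass] using smear_apply_le M (Finset.Icc 1 M) (fun k => μ (segmentCell M k)) hS
  · calc lineEnergy (smear M (Finset.Icc 1 M) fun k => μ (segmentCell M k))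
        ≤ ENNReal.ofReal (1 + ε) * (ENNReal.ofReal (1 + ε) * minEnergy) :=
          (hsmear μ).trans (mul_le_mul_right hμ.le _)
      _ = ENNReal.ofReal ((1 + ε) ^ 2) * minEnergy := by
          rw [← mul_assoc, ← ENNReal.ofReal_mul (by positivity), ← sq]

/-! ### Double sums over unions -/

section Mixtures

variable {X ι : Type*}

lemma ofReal_sum_sum_mul (A : Finset ι) {a : ι → ℝ} {b : ι → ι → ℝ} (ha : ∀ i, 0 ≤ a i)
    (hb : ∀ i j, 0 ≤ b i j) :
    ENNReal.ofReal (∑ i ∈ A, ∑ j ∈ A, a i * a j * b i j) = ∑ i ∈ A, ∑ j ∈ A,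
      ENNReal.ofReal (a i) * ENNReal.ofReal (a j) * ENNReal.ofReal (b i j) := by
  have hterm : ∀ i j, 0 ≤ a i * a j * b i j := fun i j =>
    mul_nonneg (mul_nonneg (ha i) (ha j)) (hb i j)
  rw [ENNReal.ofReal_sum_of_nonneg fun i _ => Finset.sum_nonneg fun j _ => hterm i j]
  refine Finset.sum_congr rfl fun i _ => ?_
  rw [ENNReal.ofReal_sum_of_nonneg fun j _ => hterm i j]
  refine Finset.sum_congr rfl fun j _ => ?_
  rw [ENNReal.ofReal_mul (mul_nonneg (ha i) (ha j)), ENNReal.ofReal_mul (ha i)]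

lemma sum_sum_mul_const_mul (A : Finset ι) (c : ℝ) (a : ι → ℝ) (b : ι → ι → ℝ) :
    ∑ i ∈ A, ∑ j ∈ A, a i * a j * (c * b i j) = c * ∑ i ∈ A, ∑ j ∈ A, a i * a j * b i j := by
  simp only [Finset.mul_sum, mul_left_comm c]

lemma sum_sum_fiberwise [DecidableEq ι] {K : Finset X} {A : Finset ι} {f : X → ι}
    (hf : ∀ x ∈ K, f x ∈ A) (w : X → ℝ) (b : ι → ι → ℝ) :
    ∑ i ∈ A, ∑ j ∈ A, (∑ x ∈ K with f x = i, w x) * (∑ y ∈ K with f y = j, w y) * b i j =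
      ∑ x ∈ K, ∑ y ∈ K, w x * w y * b (f x) (f y) := by
  rw [← Finset.sum_fiberwise_of_maps_to hf]
  refine Finset.sum_congr rfl fun i _ => ?_
  conv_rhs => rw [Finset.sum_comm, ← Finset.sum_fiberwise_of_maps_to hf]
  refine Finset.sum_congr rfl fun j _ => ?_
  rw [Finset.sum_mul_sum, Finset.sum_comm, Finset.sum_mul]
  refine Finset.sum_congr rfl fun y hy => ?_
  rw [Finset.sum_mul]
  refine Finset.sum_congr rfl fun x hx => ?_
  rw [(Finset.mem_filter.1 hx).2, (Finset.mem_filter.1 hy).2]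

lemma sum_sum_mixture (A : Finset ι) (K : Finset X) (a : ι → ℝ) (n : ι → X → ℝ)
    (G : X → X → ℝ) :
    ∑ x ∈ K, ∑ y ∈ K, (∑ i ∈ A, a i * n i x) * (∑ j ∈ A, a j * n j y) * G x y =
      ∑ i ∈ A, ∑ j ∈ A, a i * a j * ∑ x ∈ K, ∑ y ∈ K, n i x * n j y * G x y := by
  simp only [Finset.sum_mul_sum]
  simp only [Finset.sum_mul, Finset.mul_sum]
  calc ∑ x ∈ K, ∑ y ∈ K, ∑ i ∈ A, ∑ j ∈ A, a i * n i x * (a j * n j y) * G x y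
      = ∑ x ∈ K, ∑ i ∈ A, ∑ j ∈ A, ∑ y ∈ K, a i * n i x * (a j * n j y) * G x y := by
        refine Finset.sum_congr rfl fun x _ => ?_
        rw [Finset.sum_comm]
        exact Finset.sum_congr rfl fun i _ => Finset.sum_comm
    _ = ∑ i ∈ A, ∑ j ∈ A, ∑ x ∈ K, ∑ y ∈ K, a i * n i x * (a j * n j y) * G x y := by
        rw [Finset.sum_comm]
        exact Finset.sum_congr rfl fun i _ => Finset.sum_comm
    _ = ∑ i ∈ A, ∑ j ∈ A, ∑ x ∈ K, ∑ y ∈ K, a i * a j * (n i x * n j y * G x y) := by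
        simp only [mul_mul_mul_comm (a _) (n _ _), mul_assoc]

lemma exists_finset_coe_eq {A : Finset ι} {S : ι → Set X} (hS : ∀ i ∈ A, (S i).Finite) :
    ∃ T : ι → Finset X, ∀ i ∈ A, (T i : Set X) = S i := by
  classical
  exact ⟨fun i => if h : (S i).Finite then h.toFinset else ∅, by simp +contextual [hS]⟩

end Mixtures

lemma eucl_eq_norm (x y : ℤ × ℤ) : eucl x y = ‖toPlane (x - y)‖ := by
  rw [eucl, dist_eq_norm]
  congr 1
  ext i
  fin_cases i <;> simp [toPlane]

lemma finite_latticeBall (r : ℝ) : (latticeBall r).Finite := by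
  refine ((finite_Icc (-⌈r⌉) ⌈r⌉).prod (finite_Icc (-⌈r⌉) ⌈r⌉)).subset fun z hz => ?_
  have hnorm : ‖toPlane z‖ ≤ ⌈r⌉ := by
    rw [latticeBall, mem_ofPred_eq, eucl_eq_norm, sub_zero] at hz
    exact hz.trans (Int.le_ceil r)
  have hfst : |(z.1 : ℝ)| ≤ ⌈r⌉ := (PiLp.norm_apply_le (toPlane z) 0).trans hnorm
  have hsnd : |(z.2 : ℝ)| ≤ ⌈r⌉ := (PiLp.norm_apply_le (toPlane z) 1).trans hnorm
  exact ⟨mem_Icc.2 (abs_le.1 (by exact_mod_cast hfst)),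
    mem_Icc.2 (abs_le.1 (by exact_mod_cast hsnd))⟩

/-! ### The upper bound for the capacity of a union -/

lemma sum_fiber_equil_le {ι : Type*} [DecidableEq ι] {N : ℝ} (hN : 0 < N) {K : Finset (ℤ × ℤ)}
    {A : Finset ι} {f : ℤ × ℤ → ι} (hf : ∀ x ∈ K, f x ∈ A) {b : ι → ι → ℝ}
    (hb : ∀ x ∈ K, ∀ y ∈ K, b (f x) (f y) ≤ green N (x - y)) :
    ∑ i ∈ A, ∑ j ∈ A, (∑ x ∈ K with f x = i, equil N K x) *
      (∑ y ∈ K with f y = j, equil N K y) * b i j ≤ ∑ x ∈ K, equil N K x := by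
  rw [sum_sum_fiberwise hf, ← sum_sum_mul_equil_mul_green hN K (equil N K)]
  exact Finset.sum_le_sum fun x hx => Finset.sum_le_sum fun y hy =>
    mul_le_mul_of_nonneg_left (hb x hx y hy) (mul_nonneg (equil_nonneg _ _ _) (equil_nonneg _ _ _))

lemma minEnergy_mul_sq_sum_le {M : ℕ} (hM : 0 < M) {A : Finset ℕ} (hA : A ⊆ Finset.Icc 1 M)
    {w : ℕ → ℝ≥0∞} (hw : ∀ i ∈ A, w i ≠ ⊤) :
    minEnergy * (∑ i ∈ A, w i) ^ 2 ≤ lineEnergy (smear M A w) := by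
  have hmass : smear M A w univ = ∑ i ∈ A, w i :=
    smear_apply_of_subset hM A w MeasurableSet.univ fun i _ => subset_univ _
  have : IsFiniteMeasure (smear M A w) :=
    ⟨by rw [hmass]; exact (ENNReal.sum_ne_top.2 hw).lt_top⟩
  rw [← hmass]
  refine minEnergy_mul_sq_le _ ?_
  rw [smear_apply M A w measurableSet_Icc.compl]
  refine Finset.sum_eq_zero fun i hi => ?_
  have hdisjoint : Disjoint (Icc (0 : ℝ) 1)ᶜ (cell M i) :=
    disjoint_compl_left.mono_right ((cell_subset_Ioc (hA hi)).trans Ioc_subset_Icc_self)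
  rw [hdisjoint.inter_eq, measure_empty, mul_zero, mul_zero]

lemma ofReal_le_mul_capBrownian_of_minEnergy_mul_sq_le {a c : ℝ} (ha : 0 ≤ a) (hc : 0 ≤ c)
    (h : minEnergy * ENNReal.ofReal a ^ 2 ≤ ENNReal.ofReal (c * a)) :
    ENNReal.ofReal a ≤ ENNReal.ofReal c * capBrownian unitSegment := by
  rcases ha.eq_or_lt with rfl | hpos
  · simp
  rw [ENNReal.ofReal_mul hc, sq, ← mul_assoc, ENNReal.mul_le_mul_iff_left
    (ENNReal.ofReal_pos.2 hpos).ne' ENNReal.ofReal_ne_top] at h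
  rw [capBrownian_unitSegment, ← div_eq_mul_inv,
    ENNReal.le_div_iff_mul_le (.inl minEnergy_pos.ne') (.inr ENNReal.ofReal_ne_top), mul_comm]
  exact h

lemma capN_le_of_average_energyKernel_le {N c : ℝ} (hN : 0 < N) (hc : 0 ≤ c) {P : ℕ} (hP : 0 < P)
    {K : Finset (ℤ × ℤ)} {f : ℤ × ℤ → ℕ} (hf : ∀ x ∈ K, f x ∈ Finset.Icc 1 P) {b : ℕ → ℕ → ℝ}
    (hb : ∀ i j, 0 ≤ b i j) (hgreen : ∀ x ∈ K, ∀ y ∈ K, b (f x) (f y) ≤ green N (x - y))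
    (haverage : ∀ i ∈ Finset.Icc 1 P, ∀ j ∈ Finset.Icc 1 P, ∀ u ∈ cell P i,
      (P : ℝ≥0∞) * ∫⁻ v in cell P j, energyKernel |u - v| ≤ ENNReal.ofReal (c * b i j)) :
    capN N K ≤ ENNReal.ofReal c * capBrownian unitSegment := by
  set w : ℕ → ℝ := fun i => ∑ x ∈ K with f x = i, equil N K x
  have hw : ∀ i, 0 ≤ w i := fun i => Finset.sum_nonneg fun x _ => equil_nonneg _ _ _
  have hwsum : ∑ i ∈ Finset.Icc 1 P, w i = ∑ x ∈ K, equil N K x :=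
    Finset.sum_fiberwise_of_maps_to hf _
  have hline : lineEnergy (smear P (Finset.Icc 1 P) fun i => ENNReal.ofReal (w i)) ≤
      ENNReal.ofReal (c * ∑ i ∈ Finset.Icc 1 P, w i) := by
    refine (lineEnergy_smear_le hP _ _ _ haverage).trans ?_
    rw [← ofReal_sum_sum_mul _ hw fun i j => mul_nonneg hc (hb i j), sum_sum_mul_const_mul, hwsum]
    gcongr
    exact sum_fiber_equil_le hN hf hgreen
  rw [capN_coe_finset, ← hwsum]
  refine ofReal_le_mul_capBrownian_of_minEnergy_mul_sq_le (Finset.sum_nonneg fun i _ => hw i) hc ?_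
  rw [ENNReal.ofReal_sum_of_nonneg fun i _ => hw i]
  exact (minEnergy_mul_sq_sum_le hP subset_rfl fun i _ => ENNReal.ofReal_ne_top).trans hline

lemma exists_capN_le_of_labelling {ε c : ℝ} (hε : 0 < ε) (hε₁ : ε < 1) (hc : 1 ≤ c) :
    ∃ C : ℝ, 0 < C ∧ ∀ (N : ℝ) (P : ℕ) (K : Finset (ℤ × ℤ)) (f : ℤ × ℤ → ℕ),
      C ≤ P → P ≤ N → (∀ x ∈ K, f x ∈ Finset.Icc 1 P) →
      (∀ x ∈ K, ∀ y ∈ K, ‖toPlane (x - y)‖ ≤ (|(f x : ℝ) - f y| + c) * N / P) →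
      capN N K ≤ ENNReal.ofReal (1 + ε) * capBrownian unitSegment := by
  set t := ε / 4 with ht_def
  have ht : 0 < t := by positivity
  have ht₁ : 0 < 1 - t := by linarith
  obtain ⟨C, hC, hgreen⟩ := exists_le_green_of_near_cells ht (by linarith) hc
  obtain ⟨M₀, hM₀, haverage⟩ := exists_average_energyKernel_le ht hc
  refine ⟨C + M₀, by positivity, fun N P K f hCP hPN hf hclose => ?_⟩
  have hP : (0 : ℝ) < P := by linarith
  refine capN_le_of_average_energyKernel_le (by linarith) (by positivity) (Nat.cast_pos.1 hP) hf
    (b := fun i j => (1 - t) * brownianGreen ((|(i : ℝ) - j| + c) / P))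
    (fun i j => mul_nonneg ht₁.le (brownianGreen_nonneg _)) (fun x hx y hy => ?_)
    fun i hi j hj u hu => ?_
  · exact hgreen N P _ (x - y) (by linarith) hPN (abs_nonneg _)
      (abs_natCast_sub_le (hf x hx) (hf y hy)) (hclose x hx y hy)
  · refine (haverage P i j u (by linarith) (abs_natCast_sub_le hi hj) hu).trans ?_
    rw [← mul_assoc]
    gcongr
    · exact brownianGreen_nonneg _
    · nlinarith

lemma exists_capN_iUnion_le {ε c : ℝ} (hε : 0 < ε) (hε₁ : ε < 1) (hc : 1 ≤ c) :
    ∃ C : ℝ, 0 < C ∧ ∀ (N : ℝ) (P : ℕ) (A : Finset ℕ) (S : ℕ → Set (ℤ × ℤ)),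
      C ≤ P → P ≤ N → A ⊆ Finset.Icc 1 P → (∀ i ∈ A, (S i).Finite) →
      (∀ i ∈ A, ∀ j ∈ A, ∀ x ∈ S i, ∀ y ∈ S j, eucl x y ≤ (|(i : ℝ) - j| + c) * N / P) →
      capN N (⋃ i ∈ A, S i) ≤ ENNReal.ofReal (1 + ε) * capBrownian unitSegment := by
  obtain ⟨C, hC, hcap⟩ := exists_capN_le_of_labelling hε hε₁ hc
  refine ⟨C, hC, fun N P A S hCP hPN hA hS hclose => ?_⟩
  obtain ⟨K, hK⟩ := (A.finite_toSet.biUnion hS).exists_finset_coe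
  have hlabel : ∀ x ∈ K, ∃ i ∈ A, x ∈ S i := fun x hx => by
    simpa only [mem_iUnion₂, exists_prop, Finset.mem_coe] using
      (hK ▸ Finset.mem_coe.2 hx : x ∈ ⋃ i ∈ (A : Set ℕ), S i)
  choose! f hfA hfS using hlabel
  rw [show ⋃ i ∈ A, S i = K from hK.symm]
  refine hcap N P K f hCP hPN (fun x hx => hA (hfA x hx)) fun x hx y hy => ?_
  rw [← eucl_eq_norm]
  exact hclose _ (hfA x hx) _ (hfA y hy) x (hfS x hx) y (hfS y hy)

/-! ### The lower bound for the capacity of a union -/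

/-- The equilibrium measure of `T`, normalized to a probability measure. -/
def normEquil (N : ℝ) (T : Finset (ℤ × ℤ)) (x : ℤ × ℤ) : ℝ :=
  equil N T x / ∑ y ∈ T, equil N T y

lemma normEquil_of_notMem (N : ℝ) {T : Finset (ℤ × ℤ)} {x : ℤ × ℤ} (hx : x ∉ T) :
    normEquil N T x = 0 := by
  rw [normEquil, equil_of_notMem N (by exact_mod_cast hx), zero_div]

lemma normEquil_nonneg (N : ℝ) (T : Finset (ℤ × ℤ)) (x : ℤ × ℤ) : 0 ≤ normEquil N T x :=
  div_nonneg (equil_nonneg _ _ _) (Finset.sum_nonneg fun _ _ => equil_nonneg _ _ _)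

section NormEquil

variable {N : ℝ} {T K : Finset (ℤ × ℤ)}

lemma sum_normEquil (hT : 0 < ∑ y ∈ T, equil N T y) (hTK : T ⊆ K) :
    ∑ x ∈ K, normEquil N T x = 1 := by
  rw [← Finset.sum_subset hTK fun x _ hx => normEquil_of_notMem N hx]
  simp only [normEquil]
  rw [← Finset.sum_div, div_self hT.ne']

lemma sum_sum_normEquil_mul_green (hN : 0 < N) (hT : 0 < ∑ y ∈ T, equil N T y) (hTK : T ⊆ K) :
    ∑ x ∈ K, ∑ y ∈ K, normEquil N T x * normEquil N T y * green N (x - y) =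
      (∑ y ∈ T, equil N T y)⁻¹ := by
  have hone := sum_sum_mul_equil_mul_green hN T (normEquil N T)
  rw [sum_normEquil hT subset_rfl] at hone
  calc ∑ x ∈ K, ∑ y ∈ K, normEquil N T x * normEquil N T y * green N (x - y)
      = ∑ x ∈ T, ∑ y ∈ T, normEquil N T x * normEquil N T y * green N (x - y) := by
        rw [← Finset.sum_subset hTK fun x _ hx => by simp [normEquil_of_notMem N hx]]
        refine Finset.sum_congr rfl fun x _ => ?_
        rw [← Finset.sum_subset hTK fun y _ hy => by simp [normEquil_of_notMem N hy]]
    _ = (∑ x ∈ T, ∑ y ∈ T, normEquil N T x * equil N T y * green N (x - y)) /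
          ∑ y ∈ T, equil N T y := by
        simp only [Finset.sum_div]
        refine Finset.sum_congr rfl fun x _ => Finset.sum_congr rfl fun y _ => ?_
        rw [show normEquil N T y = equil N T y / ∑ y ∈ T, equil N T y from rfl]
        ring
    _ = (∑ y ∈ T, equil N T y)⁻¹ := by rw [hone, one_div]

lemma sum_sum_normEquil_mul_green_le {T' : Finset (ℤ × ℤ)} {b : ℝ}
    (hT : 0 < ∑ y ∈ T, equil N T y) (hT' : 0 < ∑ y ∈ T', equil N T' y) (hTK : T ⊆ K)
    (hTK' : T' ⊆ K) (hb : ∀ x ∈ T, ∀ y ∈ T', green N (x - y) ≤ b) :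
    ∑ x ∈ K, ∑ y ∈ K, normEquil N T x * normEquil N T' y * green N (x - y) ≤ b := by
  calc ∑ x ∈ K, ∑ y ∈ K, normEquil N T x * normEquil N T' y * green N (x - y)
      ≤ ∑ x ∈ K, ∑ y ∈ K, normEquil N T x * normEquil N T' y * b := by
        refine Finset.sum_le_sum fun x _ => Finset.sum_le_sum fun y _ => ?_
        by_cases hx : x ∈ T
        · by_cases hy : y ∈ T'
          · exact mul_le_mul_of_nonneg_left (hb x hx y hy)
              (mul_nonneg (normEquil_nonneg _ _ _) (normEquil_nonneg _ _ _))
          · simp [normEquil_of_notMem N hy]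
        · simp [normEquil_of_notMem N hx]
    _ = (∑ x ∈ K, normEquil N T x) * (∑ y ∈ K, normEquil N T' y) * b := by
        rw [Finset.sum_mul_sum]
        simp only [Finset.sum_mul]
    _ = b := by rw [sum_normEquil hT hTK, sum_normEquil hT' hTK', one_mul, one_mul]

end NormEquil

lemma sum_sum_le_diagonal_add {ι : Type*} (A : Finset ι) {q b : ι → ι → ℝ} {d : ι → ℝ}
    (hd : ∀ i ∈ A, q i i ≤ d i) (hb : ∀ i ∈ A, 0 ≤ b i i)
    (hq : ∀ i ∈ A, ∀ j ∈ A, i ≠ j → q i j ≤ b i j) :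
    ∑ i ∈ A, ∑ j ∈ A, q i j ≤ ∑ i ∈ A, d i + ∑ i ∈ A, ∑ j ∈ A, b i j := by
  classical
  rw [← Finset.sum_add_distrib]
  refine Finset.sum_le_sum fun i hi => ?_
  calc ∑ j ∈ A, q i j ≤ ∑ j ∈ A, ((if j = i then d i else 0) + b i j) := by
        refine Finset.sum_le_sum fun j hj => ?_
        split_ifs with hji
        · subst hji
          linarith [hd j hj, hb j hj]
        · rw [zero_add]
          exact hq i hi j hj (Ne.symm hji)
    _ = d i + ∑ j ∈ A, b i j := by
        rw [Finset.sum_add_distrib, Finset.sum_ite_eq' A i, if_pos hi]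

/- Test `sq_sum_le_energy_mul_sum_equil` on the mixture, with weights `a`, of the normalized
equilibrium measures of the parts. -/
lemma sq_sum_le_mul_sum_equil {ι : Type*} {N κ : ℝ} (hN : 0 < N) (hκ : 0 < κ) {A : Finset ι}
    {T : ι → Finset (ℤ × ℤ)} {K : Finset (ℤ × ℤ)} (hTK : ∀ i ∈ A, T i ⊆ K) {a : ι → ℝ}
    (ha : ∀ i, 0 ≤ a i) {b : ι → ι → ℝ} (hb : ∀ i, 0 ≤ b i i)
    (hcap : ∀ i ∈ A, κ ≤ ∑ x ∈ T i, equil N (T i) x)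
    (hgreen : ∀ i ∈ A, ∀ j ∈ A, i ≠ j → ∀ x ∈ T i, ∀ y ∈ T j, green N (x - y) ≤ b i j) :
    (∑ i ∈ A, a i) ^ 2 ≤ ((∑ i ∈ A, a i ^ 2) / κ + ∑ i ∈ A, ∑ j ∈ A, a i * a j * b i j) *
      ∑ x ∈ K, equil N K x := by
  have hpos : ∀ i ∈ A, 0 < ∑ x ∈ T i, equil N (T i) x := fun i hi => hκ.trans_le (hcap i hi)
  have hmass : ∑ x ∈ K, ∑ i ∈ A, a i * normEquil N (T i) x = ∑ i ∈ A, a i := by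
    rw [Finset.sum_comm]
    refine Finset.sum_congr rfl fun i hi => ?_
    rw [← Finset.mul_sum, sum_normEquil (hpos i hi) (hTK i hi), mul_one]
  have henergy := sq_sum_le_energy_mul_sum_equil hN K fun x => ∑ i ∈ A, a i * normEquil N (T i) x
  rw [hmass, sum_sum_mixture A K a (fun i => normEquil N (T i)) fun x y => green N (x - y)]
    at henergy
  refine henergy.trans (mul_le_mul_of_nonneg_right ?_
    (Finset.sum_nonneg fun x _ => equil_nonneg _ _ _))
  rw [Finset.sum_div]
  refine sum_sum_le_diagonal_add A (fun i hi => ?_)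
    (fun i _ => mul_nonneg (mul_self_nonneg _) (hb i)) fun i hi j hj hij => ?_
  · rw [sum_sum_normEquil_mul_green hN (hpos i hi) (hTK i hi), ← sq, div_eq_mul_inv]
    gcongr
    exact hcap i hi
  · exact mul_le_mul_of_nonneg_left (sum_sum_normEquil_mul_green_le (hpos i hi) (hpos j hj)
      (hTK i hi) (hTK j hj) (hgreen i hi j hj hij)) (mul_nonneg (ha i) (ha j))

lemma iUnion_cell {M : ℕ} (hM : 0 < M) : ⋃ i ∈ Finset.Icc 1 M, cell M i = Ioc 0 1 := by
  refine Subset.antisymm (iUnion₂_subset fun i hi => cell_subset_Ioc hi) fun u hu => ?_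
  have hMu : 0 < (M : ℝ) * u := mul_pos (Nat.cast_pos.2 hM) hu.1
  refine mem_iUnion₂.2 ⟨⌈(M : ℝ) * u⌉₊, Finset.mem_Icc.2 ⟨Nat.ceil_pos.2 hMu,
    Nat.ceil_le.2 (mul_le_of_le_one_right (Nat.cast_nonneg _) hu.2)⟩, (mem_cell hM).2 ⟨?_, ?_⟩⟩
  · linarith [Nat.ceil_lt_add_one hMu.le]
  · exact Nat.le_ceil _

lemma exists_weights_energy_le {ε : ℝ} (hε : 0 < ε) (hfinite : minEnergy ≠ ⊤) :
    ∃ M : ℕ, 0 < M ∧ ∀ P : ℕ, 0 < P → ∃ a : ℕ → ℝ, (∀ i, 0 ≤ a i) ∧ (∀ i, a i ≤ M / P) ∧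
      ∑ i ∈ Finset.Icc 1 P, a i = 1 ∧
      ∑ i ∈ Finset.Icc 1 P, ∑ j ∈ Finset.Icc 1 P,
        a i * a j * brownianGreen ((|(i : ℝ) - j| + 1) / P) ≤
          (1 + ε) ^ 2 * minEnergy.toReal := by
  obtain ⟨M, ρ, hM, _, hmass, hdensity, henergy⟩ :=
    exists_lineEnergy_le_of_bounded_density hε hfinite
  refine ⟨M, hM, fun P hP => ⟨fun i => ρ.real (cell P i), fun i => measureReal_nonneg,
    fun i => ?_, ?_, ?_⟩⟩
  · have hvolume : volume (cell P i) = (P : ℝ≥0∞)⁻¹ :=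
      ENNReal.eq_inv_of_mul_eq_one_left ((mul_comm _ _).trans (mul_volume_cell hP i))
    have hcell := hdensity _ (measurableSet_cell P i)
    rw [hvolume] at hcell
    simpa [Measure.real, div_eq_mul_inv] using ENNReal.toReal_mono
      (ENNReal.mul_ne_top (ENNReal.natCast_ne_top M)
        (ENNReal.inv_ne_top.2 (Nat.cast_ne_zero.2 hP.ne'))) hcell
  · rw [← measureReal_biUnion_finset (pairwiseDisjoint_cell hP _)
      fun i _ => measurableSet_cell P i, iUnion_cell hP, Measure.real, hmass, ENNReal.toReal_one]
  · have hP' : (0 : ℝ) < P := Nat.cast_pos.2 hP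
    refine (ENNReal.ofReal_le_ofReal_iff (by positivity)).1 ?_
    rw [ofReal_sum_sum_mul _ (fun i => measureReal_nonneg) fun i j => brownianGreen_nonneg _,
      ENNReal.ofReal_mul (by positivity), ENNReal.ofReal_toReal hfinite]
    have hcell : ∀ i, ENNReal.ofReal (ρ.real (cell P i)) = ρ (cell P i) := fun i =>
      ofReal_measureReal
    simp only [hcell]
    refine (sum_mul_le_lintegral_lintegral ρ _ (measurableSet_cell P) (pairwiseDisjoint_cell hP _)
      (fun u v => energyKernel |u - v|) _ fun i _ j _ u hu v hv => ?_).trans henergy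
    have hpos : 0 < (|(i : ℝ) - j| + 1) / P := by positivity
    rw [← energyKernel_eq hpos]
    refine antitoneOn_energyKernel (mem_Ici.2 (abs_nonneg _)) (mem_Ici.2 hpos.le) ?_
    rw [le_div_iff₀' hP']
    linarith [(abs_le.1 (abs_mul_abs_sub_sub_abs_le_one_of_mem_cell hP hu hv)).2]

lemma one_sub_le_sum_of_card {ι : Type*} {A B : Finset ι} (hAB : A ⊆ B) {a : ι → ℝ} {t m : ℝ}
    (ham : ∀ i, a i ≤ m) (hsum : ∑ i ∈ B, a i = 1) (hcard : ((B.card : ℝ) - A.card) * m ≤ t) :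
    1 - t ≤ ∑ i ∈ A, a i := by
  classical
  have hrest : ∑ i ∈ B \ A, a i ≤ t := by
    refine (Finset.sum_le_card_nsmul _ _ _ fun i _ => ham i).trans ?_
    rwa [Finset.card_sdiff_of_subset hAB, nsmul_eq_mul, Nat.cast_sub (Finset.card_le_card hAB)]
  linarith [Finset.sum_sdiff (f := a) hAB]

lemma sum_sq_le {ι : Type*} (A : Finset ι) {a : ι → ℝ} {m : ℝ} (ha : ∀ i, 0 ≤ a i)
    (ham : ∀ i, a i ≤ m) (hm : 0 ≤ m) (hsum : ∑ i ∈ A, a i ≤ 1) : ∑ i ∈ A, a i ^ 2 ≤ m := by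
  calc ∑ i ∈ A, a i ^ 2 ≤ ∑ i ∈ A, m * a i :=
        Finset.sum_le_sum fun i _ => by
          rw [sq]
          exact mul_le_mul_of_nonneg_right (ham i) (ha i)
    _ = m * ∑ i ∈ A, a i := (Finset.mul_sum _ _ _).symm
    _ ≤ m := mul_le_of_le_one_right hm hsum

lemma one_le_abs_natCast_sub {i j : ℕ} (hij : i ≠ j) : 1 ≤ |(i : ℝ) - j| := by
  exact_mod_cast Int.one_le_abs (sub_ne_zero.2 (Nat.cast_injective.ne hij) : (i : ℤ) - j ≠ 0)

lemma exists_one_sub_sq_le_mul_sum_equil {t δ : ℝ} (ht : 0 < t) (ht₁ : t ≤ 1)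
    (hδ : δ ∈ Ioo (0 : ℝ) 1) (hfinite : minEnergy ≠ ⊤) :
    ∃ M : ℕ, 0 < M ∧ ∃ C : ℝ, 0 < C ∧
      ∀ (N : ℝ) (P : ℕ) (A : Finset ℕ) (T : ℕ → Finset (ℤ × ℤ)) (κ : ℝ),
        C ≤ P → P ≤ N → A ⊆ Finset.Icc 1 P → (1 - t / M) * P ≤ A.card → 0 < κ →
        (∀ i ∈ A, ∀ j ∈ A, i ≠ j → ∀ x ∈ T i, ∀ y ∈ T j,
          (|(i : ℝ) - j| - δ) * N / P ≤ ‖toPlane (x - y)‖) →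
        (∀ i ∈ A, κ ≤ ∑ x ∈ T i, equil N (T i) x) →
        (1 - t) ^ 2 ≤ (M / P / κ + (1 + t) ^ 3 * minEnergy.toReal) *
          ∑ x ∈ A.biUnion T, equil N (A.biUnion T) x := by
  obtain ⟨M, hM, hweights⟩ := exists_weights_energy_le ht hfinite
  obtain ⟨C, hC, hgreen⟩ := exists_green_le_of_far_cells ht hδ
  refine ⟨M, hM, C, hC, fun N P A T κ hCP hPN hA hcard hκ hfar hcap => ?_⟩
  have : (0 : ℝ) < M := Nat.cast_pos.2 hM
  have hP : (0 : ℝ) < P := hC.trans_le hCP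
  obtain ⟨a, ha, haM, hsum, henergy⟩ := hweights P (Nat.cast_pos.1 hP)
  set b : ℕ → ℕ → ℝ := fun i j => brownianGreen ((|(i : ℝ) - j| + 1) / P)
  have hb : ∀ i j, 0 ≤ b i j := fun i j => brownianGreen_nonneg _
  have hmixture := sq_sum_le_mul_sum_equil (hP.trans_le hPN) hκ
    (fun i hi => Finset.subset_biUnion_of_mem T hi) ha (b := fun i j => (1 + t) * b i j)
    (fun i => mul_nonneg (by positivity) (hb i i)) hcap fun i hi j hj hij x hx y hy =>
      hgreen N P _ (x - y) hCP hPN (one_le_abs_natCast_sub hij)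
        (abs_natCast_sub_le (hA hi) (hA hj)) (hfar i hi j hj hij x hx y hy)
  have hmass : 1 - t ≤ ∑ i ∈ A, a i := by
    refine one_sub_le_sum_of_card hA haM hsum ?_
    rw [Nat.card_Icc, Nat.add_sub_cancel]
    calc ((P : ℝ) - A.card) * (M / P) ≤ t / M * P * (M / P) := by gcongr; linarith
      _ = t := by field_simp
  have hsq : ∑ i ∈ A, a i ^ 2 ≤ M / P := sum_sq_le A ha haM (by positivity)
    (hsum ▸ Finset.sum_le_sum_of_subset_of_nonneg hA fun i _ _ => ha i)
  have henergyA : ∑ i ∈ A, ∑ j ∈ A, a i * a j * b i j ≤ (1 + t) ^ 2 * minEnergy.toReal := by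
    have hterm : ∀ i j, 0 ≤ a i * a j * b i j := fun i j =>
      mul_nonneg (mul_nonneg (ha i) (ha j)) (hb i j)
    refine le_trans ?_ henergy
    refine (Finset.sum_le_sum fun i _ => Finset.sum_le_sum_of_subset_of_nonneg hA
      fun j _ _ => hterm i j).trans ?_
    exact Finset.sum_le_sum_of_subset_of_nonneg hA fun i _ _ => Finset.sum_nonneg
      fun j _ => hterm i j
  rw [sum_sum_mul_const_mul] at hmixture
  calc (1 - t) ^ 2 ≤ (∑ i ∈ A, a i) ^ 2 := by gcongr
    _ ≤ _ := hmixture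
    _ ≤ (M / P / κ + (1 + t) * ((1 + t) ^ 2 * minEnergy.toReal)) *
          ∑ x ∈ A.biUnion T, equil N (A.biUnion T) x := by
        gcongr
        exact Finset.sum_nonneg fun x _ => equil_nonneg _ _ _
    _ = _ := by ring

lemma one_add_pow_three_le {t : ℝ} (ht : 0 < t) (ht₁ : t < 1 / 16) :
    (1 + t) ^ 3 ≤ (1 + 16 * t) * (1 - t) ^ 2 := by
  nlinarith [mul_pos ht ht, mul_pos (mul_pos ht ht) ht]

lemma inv_le_of_one_sub_sq_le {t M P κ e cap : ℝ} (ht : 0 < t) (ht₁ : t < 1 / 16) (hM : 0 < M)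
    (hP : 0 < P) (hκ : 0 < κ) (he : 0 ≤ e) (hcap : 0 ≤ cap)
    (hsq : (1 - t) ^ 2 ≤ (M / P / κ + (1 + t) ^ 3 * e) * cap) :
    (((1 - t) ^ 2 / M * κ * P)⁻¹ + (1 + 16 * t) * e)⁻¹ ≤ cap := by
  have ht' : 0 < 1 - t := by linarith
  have henergy : M / P / κ + (1 + t) ^ 3 * e ≤
      (1 - t) ^ 2 * (((1 - t) ^ 2 / M * κ * P)⁻¹ + (1 + 16 * t) * e) := by
    calc M / P / κ + (1 + t) ^ 3 * e
        ≤ M / P / κ + (1 + 16 * t) * (1 - t) ^ 2 * e := by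
          gcongr
          exact one_add_pow_three_le ht ht₁
      _ = (1 - t) ^ 2 * (((1 - t) ^ 2 / M * κ * P)⁻¹ + (1 + 16 * t) * e) := by
          field_simp
  refine (inv_le_iff_one_le_mul₀' (by positivity)).2 (le_of_mul_le_mul_left ?_ (pow_pos ht' 2))
  rw [mul_one, ← mul_assoc]
  exact hsq.trans (mul_le_mul_of_nonneg_right henergy hcap)

lemma le_norm_of_ofReal_le_setDist {S S' : Set (ℤ × ℤ)} {r : ℝ}
    (hr : ENNReal.ofReal r ≤ setDist S S') {x y : ℤ × ℤ} (hx : x ∈ S) (hy : y ∈ S') :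
    r ≤ ‖toPlane (x - y)‖ := by
  rw [← ENNReal.ofReal_le_ofReal_iff (norm_nonneg _), ← eucl_eq_norm]
  exact hr.trans (iInf₂_le_of_le x hx (iInf₂_le y hy))

lemma inv_ofReal_add_inv_eq {r s : ℝ} (hr : 0 < r) (hs : 0 < s) (hfinite : minEnergy ≠ ⊤) :
    ((ENNReal.ofReal r)⁻¹ + ENNReal.ofReal s * minEnergy)⁻¹ =
      ENNReal.ofReal (r⁻¹ + s * minEnergy.toReal)⁻¹ := by
  rw [ENNReal.ofReal_inv_of_pos (by positivity), ENNReal.ofReal_add (by positivity)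
    (by positivity), ENNReal.ofReal_inv_of_pos hr, ENNReal.ofReal_mul hs.le,
    ENNReal.ofReal_toReal hfinite]

theorem exists_le_capN_iUnion {ε δ : ℝ} (hε : ε ∈ Ioo (0 : ℝ) 1) (hδ : δ ∈ Ioo (0 : ℝ) 1) :
    ∃ c₁ ∈ Ioo (0 : ℝ) 1, ∃ c₂ : ℝ, 0 < c₂ ∧ ∃ C : ℝ, 0 < C ∧
      ∀ (N : ℝ) (P : ℕ) (A : Finset ℕ) (S : ℕ → Set (ℤ × ℤ)) (κ : ℝ),
        C ≤ P → P ≤ N → A ⊆ Finset.Icc 1 P → c₁ * P ≤ A.card → (∀ i ∈ A, (S i).Finite) → 0 < κ →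
        (∀ i ∈ A, ∀ j ∈ A, i ≠ j →
          ENNReal.ofReal ((|(i : ℝ) - j| - δ) * N / P) ≤ setDist (S i) (S j)) →
        (∀ i ∈ A, ENNReal.ofReal κ ≤ capN N (S i)) →
        ((ENNReal.ofReal (c₂ * κ * P))⁻¹ +
          ENNReal.ofReal (1 + ε) * (capBrownian unitSegment)⁻¹)⁻¹ ≤ capN N (⋃ i ∈ A, S i) := by
  have hε' : 0 < 1 + ε := by linarith [hε.1]
  rw [capBrownian_unitSegment, inv_inv]
  rcases eq_or_ne minEnergy ⊤ with hinfinite | hfinite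
  · refine ⟨1 / 2, by norm_num, 1, one_pos, 1, one_pos, fun N P A S κ _ _ _ _ _ _ _ _ => ?_⟩
    simp [hinfinite, hε']
  obtain ⟨t, rfl⟩ : ∃ t, 16 * t = ε := ⟨ε / 16, by ring⟩
  have ht : 0 < t := by linarith [hε.1]
  have ht₁ : t < 1 / 16 := by linarith [hε.2]
  have hsq_pos : 0 < (1 - t) ^ 2 := pow_pos (by linarith) 2
  obtain ⟨M, hM, C, hC, hbound⟩ := exists_one_sub_sq_le_mul_sum_equil ht (by linarith) hδ hfinite
  have hM' : (0 : ℝ) < M := Nat.cast_pos.2 hM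
  have htM : t / M ≤ t := div_le_self ht.le (Nat.one_le_cast.2 hM)
  refine ⟨1 - t / M, ⟨by linarith, by linarith [div_pos ht hM']⟩, (1 - t) ^ 2 / M,
    div_pos hsq_pos hM', C, hC, fun N P A S κ hCP hPN hA hcard hS hκ hfar hcap => ?_⟩
  have hP : (0 : ℝ) < P := hC.trans_le hCP
  obtain ⟨T, hT⟩ := exists_finset_coe_eq hS
  have hunion : ⋃ i ∈ A, S i = (A.biUnion T : Finset (ℤ × ℤ)) := by
    rw [Finset.coe_biUnion]
    exact iUnion₂_congr fun i hi => (hT i hi).symm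
  have hequil : ∀ K : Finset (ℤ × ℤ), 0 ≤ ∑ x ∈ K, equil N K x := fun K =>
    Finset.sum_nonneg fun x _ => equil_nonneg _ _ _
  rw [inv_ofReal_add_inv_eq (by positivity) hε' hfinite, hunion, capN_coe_finset]
  refine ENNReal.ofReal_le_ofReal (inv_le_of_one_sub_sq_le ht ht₁ hM' hP hκ
    ENNReal.toReal_nonneg (hequil _) (hbound N P A T κ hCP hPN hA hcard hκ ?_ fun i hi => ?_))
  · exact fun i hi j hj hij x hx y hy => le_norm_of_ofReal_le_setDist (hfar i hi j hj hij)
      (hT i hi ▸ hx) (hT j hj ▸ hy)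
  · rw [← ENNReal.ofReal_le_ofReal_iff (hequil _), ← capN_coe_finset, hT i hi]
    exact hcap i hi

end

end PorousTube

theorem mainTheorem5_general (ε δ : ℝ) (hε : ε ∈ Set.Ioo (0 : ℝ) 1) (hδ : δ ∈ Set.Ioo (0 : ℝ) 1) :
    ∃ c₁ ∈ Set.Ioo (0 : ℝ) 1, ∃ c₂ : ℝ, 0 < c₂ ∧ ∃ C : ℝ, 0 < C ∧
      ∀ (N : ℝ) (P : ℕ) (A : Finset ℕ) (S : ℕ → Set (ℤ × ℤ)),
        C ≤ (P : ℝ) → (P : ℝ) ≤ N →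
        A ⊆ Finset.Icc 1 P → c₁ * (P : ℝ) ≤ (A.card : ℝ) →
        (∀ i ∈ A, (S i).Finite) →
        (∀ κ : ℝ, 0 < κ →
          (∀ i ∈ A, ∀ j ∈ A, i ≠ j →
            ENNReal.ofReal ((|(i : ℝ) - (j : ℝ)| - δ) * N / P) ≤ PorousTube.setDist (S i) (S j)) →
          (∀ i ∈ A, ENNReal.ofReal κ ≤ PorousTube.capN N (S i)) →
          ((ENNReal.ofReal (c₂ * κ * P))⁻¹ + ENNReal.ofReal (1 + ε) *
              (PorousTube.capBrownian PorousTube.unitSegment)⁻¹)⁻¹ ≤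
            PorousTube.capN N (⋃ i ∈ A, S i)) ∧
        ((∀ i ∈ A, ∀ j ∈ A, ∀ x₁ ∈ S i, ∀ x₂ ∈ S j,
            PorousTube.eucl x₁ x₂ ≤ (|(i : ℝ) - (j : ℝ)| + 1 / δ) * N / P) →
          PorousTube.capN N (⋃ i ∈ A, S i) ≤
            ENNReal.ofReal (1 + ε) * PorousTube.capBrownian PorousTube.unitSegment) := by
  obtain ⟨c₁, hc₁, c₂, hc₂, C, hC, hlower⟩ := PorousTube.exists_le_capN_iUnion hε hδ
  obtain ⟨C', hC', hupper⟩ :=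
    PorousTube.exists_capN_iUnion_le hε.1 hε.2 ((one_le_div hδ.1).2 hδ.2.le)
  refine ⟨c₁, hc₁, c₂, hc₂, C + C', by positivity, fun N P A S hCP hPN hA hcard hS =>
    ⟨fun κ hκ hfar hcap => ?_, fun hclose => ?_⟩⟩
  · exact hlower N P A S κ (by linarith) hPN hA hcard hS hκ hfar hcap
  · exact hupper N P A S (by linarith) hPN hA hS hclose

theorem mainTheorem5 (ε δ : ℝ) (hε : ε ∈ Set.Ioo (0 : ℝ) 1) (hδ : δ ∈ Set.Ioo (0 : ℝ) 1) :
    ∃ c₁ ∈ Set.Ioo (0 : ℝ) 1, ∃ c₂ : ℝ, 0 < c₂ ∧ ∃ C : ℝ, 0 < C ∧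
      ∀ (N : ℝ) (P : ℕ) (A : Finset ℕ) (S : ℕ → Set (ℤ × ℤ)),
        C ≤ N → C ≤ (P : ℝ) → (P : ℝ) ≤ N →
        A ⊆ Finset.Icc 1 P → c₁ * (P : ℝ) ≤ (A.card : ℝ) →
        (∀ i ∈ A, S i ⊆ PorousTube.latticeBall (2 * N)) →
        (∀ κ : ℝ, 0 < κ →
          (∀ i ∈ A, ∀ j ∈ A, i ≠ j →
            ENNReal.ofReal ((|(i : ℝ) - (j : ℝ)| - δ) * N / P) ≤ PorousTube.setDist (S i) (S j)) →
          (∀ i ∈ A, ENNReal.ofReal κ ≤ PorousTube.capN N (S i)) →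
          ((ENNReal.ofReal (c₂ * κ * P))⁻¹
              + ENNReal.ofReal (1 + ε) * (PorousTube.capBrownian PorousTube.unitSegment)⁻¹)⁻¹
            ≤ PorousTube.capN N (⋃ i ∈ A, S i)) ∧
        ((∀ i ∈ A, ∀ j ∈ A, ∀ x₁ ∈ S i, ∀ x₂ ∈ S j,
            PorousTube.eucl x₁ x₂ ≤ (|(i : ℝ) - (j : ℝ)| + 1 / δ) * N / P) →
          PorousTube.capN N (⋃ i ∈ A, S i) ≤ ENNReal.ofReal (1 + ε) * PorousTube.capBrownian PorousTube.unitSegment) := by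
  obtain ⟨c₁, hc₁, c₂, hc₂, C, hC, h⟩ := mainTheorem5_general ε δ hε hδ
  exact ⟨c₁, hc₁, c₂, hc₂, C, hC, fun N P A S _ hCP hPN hA hcard hS =>
    h N P A S hCP hPN hA hcard fun i hi => (PorousTube.finite_latticeBall _).subset (hS i hi)⟩
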